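/- Let $d\ge 1$ and $N\ge 0$ be integers. Write $(a)_n=a(a+1)\cdots(a+n-1)$, and let $\Delta_N=\{x\in\mathbb N_0^d: 0\le x_1\le\cdots\le x_d\le N\}$ with the conventions $x_0=0$, $x_{d+1}=N$. For $\beta=(\beta_0,\dots,\beta_{d+1})\in\mathbb R^{d+2}$ and $x\in\Delta_N$ put $$w_{\mathsf R}(x;\beta,N)=\prod_{j=0}^d\frac{(\beta_{j+1}-\beta_j)_{x_{j+1}-x_j}(\beta_{j+1})_{x_{j+1}+x_j}}{(x_{j+1}-x_j)!\,(\beta_j+1)_{x_{j+1}+x_j}}\prod_{j=1}^d\frac{((\beta_j+2)/2)_{x_j}}{(\beta_j/2)_{x_j}},$$ and for $\nu\in\mathbb N_0^d$, with $s_j=\nu_1+\cdots+\nu_j$ and $|\nu|=s_d\le N$, $$\mathsf R_\nu(x;\beta,N)=\prod_{j=1}^d(2s_{j-1}+\beta_j-\beta_0)_{\nu_j}(s_{j-1}+\beta_{j+1}+x_{j+1})_{\nu_j}(s_{j-1}-x_{j+1})_{\nu_j}\;{}_4F_3\!\left(\begin{matrix}-\nu_j,\ \nu_j+2s_{j-1}+\beta_{j+1}-\beta_0-1,\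 s_{j-1}-x_j,\ s_{j-1}+\beta_j+x_j\\ 2s_{j-1}+\beta_j-\beta_0,\ s_{j-1}+\beta_{j+1}+x_{j+1},\ s_{j-1}-x_{j+1}\end{matrix};1\right),$$ each factor being read as a polynomial in its parameters (the Pochhammer symbols in the denominators of the ${}_4F_3$ are cancelled against the prefactors). Where $w_{\mathsf R}(\cdot;\beta,N)$ is positive on $\Delta_N$, the orthonormal multivariable Racah polynomials are $$\widehat{\mathsf R}_\nu(x;\beta,N)=\frac{\mathsf R_\nu(x;\beta,N)}{r_\nu(\beta,N)},\qquad r_\nu(\beta,N)=\Big(\sum_{y\in\Delta_N}w_{\mathsf R}(y;\beta,N)\,\mathsf R_\nu(y;\beta,N)^2\Big)^{1/2}.$$ For $x\in\Delta_N$ and $|\nu|\le N$ define the dual data $$\tilde x_j=N-s_{d+1-j},\quad \tilde\nu_j=x_{d+2-j}-x_{d+1-j}\quad(1\le j\le d),\qquad \tilde\beta_0=\beta_0,\quad \tilde\beta_j=\beta_0-\beta_{d+2-j}-2N+1\quad(1\le j\le d+1).$$ Assume $\beta_0>-1$ and $\beta_1<\beta_2<\cdots<\beta_{d+1}$ (conditions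 that $\tilde\beta$ satisfies as well). (a) If the weights $w_{\mathsf R}(\cdot;\beta,N)$ and $w_{\mathsf R}(\cdot;\tilde\beta,N)$ are well defined (no denominator vanishes) and positive on $\Delta_N$, then for all $x\in\Delta_N$ and all $\nu\in\mathbb N_0^d$ with $|\nu|\le N$ we have $\tilde x\in\Delta_N$, $|\tilde\nu|\le N$, $r_\nu(\beta,N)>0$, $r_{\tilde\nu}(\tilde\beta,N)>0$, and $$\sqrt{w_{\mathsf R}(x;\beta,N)}\;\widehat{\mathsf R}_\nu(x;\beta,N)=\sqrt{w_{\mathsf R}(\tilde x;\tilde\beta,N)}\;\widehat{\mathsf R}_{\tilde\nu}(\tilde x;\tilde\beta,N).$$ (b) The positivity hypotheses of (a) hold whenever $\beta_0<\beta_1$, $\beta_{d+1}>0$, $\beta_j\ne0$ for $1\le j\le d$, and $\beta_j\ne\beta_0+1$ for $2\le j\le d+1$. -/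

import Mathlib

namespace MultiRacah

open scoped BigOperators

/-- The rising factorial (Pochhammer symbol) `(a)_n = a (a + 1) ⋯ (a + n - 1)`. -/
noncomputable def poch (a : ℝ) (n : ℕ) : ℝ := (ascPochhammer ℝ n).eval a

/-- The node sequence `x_0 = 0, x_1, …, x_d, x_{d+1} = N` attached to `x = (x_1, …, x_d)`:
the coordinate `x_j` of the text is `x ⟨j - 1, _⟩`. (Values beyond `d + 1` are never used.) -/
def node {d : ℕ} (N : ℕ) (x : Fin d → ℕ) (j : ℕ) : ℕ :=
  if j = 0 then 0 else if h : j - 1 < d then x ⟨j - 1, h⟩ else N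

/-- The entry `ν_j` (`1 ≤ j ≤ d`) of a multi-index `ν = (ν_1, …, ν_d)`, with 0 for other `j`. -/
def entry {d : ℕ} (ν : Fin d → ℕ) (j : ℕ) : ℕ :=
  if j = 0 then 0 else if h : j - 1 < d then ν ⟨j - 1, h⟩ else 0

/-- The partial sum `ν_1 + ⋯ + ν_j`. -/
def partialSum {d : ℕ} (ν : Fin d → ℕ) (j : ℕ) : ℕ := ∑ i ∈ Finset.Icc 1 j, entry ν i

open Classical in
/-- The simplex `{x ∈ ℕ^d : 0 ≤ x_1 ≤ x_2 ≤ ⋯ ≤ x_d ≤ N}`. -/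
noncomputable def simplex (d N : ℕ) : Finset (Fin d → ℕ) :=
  (Fintype.piFinset fun _ : Fin d => Finset.range (N + 1)).filter Monotone

/-- The weight `w(x; β, N)`. Only `β 0, …, β (d + 1)` occur. -/
noncomputable def weight {d : ℕ} (x : Fin d → ℕ) (β : ℕ → ℝ) (N : ℕ) : ℝ :=
  (∏ j ∈ Finset.range (d + 1),
    (poch (β (j + 1) - β j) (node N x (j + 1) - node N x j)
        * poch (β (j + 1)) (node N x (j + 1) + node N x j))
      / (((node N x (j + 1) - node N x j).factorial : ℝ)
        * poch (β j + 1) (node N x (j + 1) + node N x j)))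
  * ∏ j ∈ Finset.Icc 1 d, poch ((β j + 2) / 2) (node N x j) / poch (β j / 2) (node N x j)

/-- The terminating series `₄F₃(-n, b, c, e; u, v, w; 1)`. -/
noncomputable def hyp43 (n : ℕ) (b c e u v w : ℝ) : ℝ :=
  ∑ k ∈ Finset.range (n + 1),
    (poch (-(n : ℝ)) k * poch b k * poch c k * poch e k)
      / (poch u k * poch v k * poch w k * (k.factorial : ℝ))

/-- The product `(u)_n (v)_n (w)_n ₄F₃(-n, b, c, e; u, v, w; 1)`, read as a polynomial in all
its parameters: `(u)_n / (u)_k` is the polynomial `(u + k)_{n - k}` for `k ≤ n`, so that zero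
lower parameters cause no trouble. See `clearedHyp43_eq`. -/
noncomputable def clearedHyp43 (n : ℕ) (b c e u v w : ℝ) : ℝ :=
  ∑ k ∈ Finset.range (n + 1),
    (poch (-(n : ℝ)) k * poch b k * poch c k * poch e k) / (k.factorial : ℝ)
      * (poch (u + k) (n - k) * poch (v + k) (n - k) * poch (w + k) (n - k))

theorem poch_split (u : ℝ) {k n : ℕ} (h : k ≤ n) :
    poch u n = poch u k * poch (u + k) (n - k) := by
  have := ascPochhammer_mul (S := ℝ) k (n - k)
  rw [Nat.add_sub_cancel' h] at this
  simp only [poch]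
  rw [← this]
  simp

theorem clearedHyp43_eq (n : ℕ) (b c e u v w : ℝ)
    (hu : poch u n ≠ 0) (hv : poch v n ≠ 0) (hw : poch w n ≠ 0) :
    clearedHyp43 n b c e u v w
      = poch u n * poch v n * poch w n * hyp43 n b c e u v w := by
  unfold clearedHyp43 hyp43
  rw [Finset.mul_sum]
  refine Finset.sum_congr rfl fun k hk => ?_
  have hkn : k ≤ n := Nat.lt_succ_iff.mp (Finset.mem_range.mp hk)
  rw [poch_split u hkn] at hu ⊢
  rw [poch_split v hkn] at hv ⊢
  rw [poch_split w hkn] at hw ⊢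
  have h1 := left_ne_zero_of_mul hu
  have h2 := left_ne_zero_of_mul hv
  have h3 := left_ne_zero_of_mul hw
  have h4 : (k.factorial : ℝ) ≠ 0 := by positivity
  field_simp

/-- Tratnik's multivariable Racah polynomial `R_ν(x; β, N)` at a point `x` of the simplex. -/
noncomputable def racah {d : ℕ} (ν : Fin d → ℕ) (x : Fin d → ℕ) (β : ℕ → ℝ) (N : ℕ) : ℝ :=
  ∏ j ∈ Finset.Icc 1 d,
    clearedHyp43 (entry ν j)
      (entry ν j + 2 * partialSum ν (j - 1) + β (j + 1) - β 0 - 1)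
      (partialSum ν (j - 1) - node N x j)
      (partialSum ν (j - 1) + β j + node N x j)
      (2 * partialSum ν (j - 1) + β j - β 0)
      (partialSum ν (j - 1) + β (j + 1) + node N x (j + 1))
      (partialSum ν (j - 1) - node N x (j + 1))

/-- The norm of `R_ν(·; β, N)` in the weighted `ℓ²` space on the simplex. -/
noncomputable def racahNorm {d : ℕ} (ν : Fin d → ℕ) (β : ℕ → ℝ) (N : ℕ) : ℝ :=
  Real.sqrt (∑ y ∈ simplex d N, weight y β N * racah ν y β N ^ 2)

/-- The normalized (orthonormal) Racah polynomial. -/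
noncomputable def orthoRacah {d : ℕ} (ν : Fin d → ℕ) (x : Fin d → ℕ) (β : ℕ → ℝ) (N : ℕ) : ℝ :=
  racah ν x β N / racahNorm ν β N

/-- Dual variables: `x̃_j = N - (ν_1 + ⋯ + ν_{d+1-j})` for `j = 1, …, d`
(`j = i + 1`; the subtraction is exact when `|ν| ≤ N`). -/
def dualVar {d : ℕ} (ν : Fin d → ℕ) (N : ℕ) : Fin d → ℕ :=
  fun i => N - partialSum ν (d - (i : ℕ))

/-- Dual indices: `ν̃_j = x_{d+2-j} - x_{d+1-j}` for `j = 1, …, d` (`j = i + 1`). -/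
def dualIndex {d : ℕ} (x : Fin d → ℕ) (N : ℕ) : Fin d → ℕ :=
  fun i => node N x (d + 1 - (i : ℕ)) - node N x (d - (i : ℕ))

/-- Dual parameters: `β̃_0 = β_0` and `β̃_j = β_0 - β_{d+2-j} - 2N + 1` for `j = 1, …, d + 1`. -/
def dualParam (d : ℕ) (β : ℕ → ℝ) (N : ℕ) : ℕ → ℝ :=
  fun j => if j = 0 then β 0 else β 0 - β (d + 2 - j) - 2 * N + 1

end MultiRacah

namespace MultiRacah

open scoped BigOperators

/-! Write w, R, r for the weight, polynomial and norm at (x, ν, β), and w', R', r' for those at the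
dual data. Let c and c' be the values of `dualCoeff` at (ν, β) and at the dual data, and put K =
(β_{d+1})_{2N} (β_1 - β_0)_{2N}. Two identities carry the theorem: c' R = c R'
(`dualCoeff_mul_racah`) and r² w' = K c² (`normSq_mul_weight_dual`). Dualizing twice gives back x
and β, and K is self-dual, so the second identity also yields r'² w = K c'². Monotonicity of β makes
c, c' positive, and K ≠ 0 for N ≥ 1, so the norms are positive; square roots then give √w R r' = √K
c' R = √K c R' = √w' R' r. The case N = 0 is trivial.

The first identity comes from one variable. The Sears–Whipple transformation brings a Racah
polynomial and its dual to the same lower parameters, where a terminating series is symmetric in the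
two pairs that contain its terminating parameters. In several variables these dualities are
multiplied, and their prefactors telescope.

The second identity rests on an explicit norm. The weight couples only neighbouring coordinates, so
the squared norm is an iterated sum, and each summation is a one-variable norm with shifted
parameters (`sum_partialNorm`). In one variable, duality turns weight times polynomial into a
combination of divided differences of orders n, …, N at the nodes x(β_1 + x). Applied to the
polynomial itself, of degree at most n in x(β_1 + x), only order n survives (`racahOne_norm`).

Part (b) is a sign count: each site factor cancels the one factor of a neighbouring Pochhammer
symbol whose sign is not controlled. -/

/-! ### Rising factorials. -/

@[simp] theorem poch_zero (a : ℝ) : poch a 0 = 1 := by simp [poch]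

theorem poch_succ (a : ℝ) (n : ℕ) : poch a (n + 1) = poch a n * (a + n) := by
  simp [poch, ascPochhammer_succ_eval]

theorem poch_add (a : ℝ) (m n : ℕ) : poch a (m + n) = poch a m * poch (a + m) n := by
  rw [poch_split a (Nat.le_add_right m n), Nat.add_sub_cancel_left]

theorem poch_one (a : ℝ) : poch a 1 = a := by simp [poch_succ a 0]

theorem poch_succ_left (a : ℝ) (n : ℕ) : poch a (n + 1) = a * poch (a + 1) n := by
  rw [add_comm, poch_add, poch_one, Nat.cast_one]

theorem poch_eq_prod (a : ℝ) (n : ℕ) : poch a n = ∏ i ∈ Finset.range n, (a + i) := by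
  induction n with
  | zero => simp
  | succ n ih => rw [poch_succ, ih, Finset.prod_range_succ]

theorem poch_pos {a : ℝ} (h : 0 < a) (n : ℕ) : 0 < poch a n := ascPochhammer_pos n a h

theorem poch_ne_zero_of_le {a : ℝ} {m n : ℕ} (h : poch a n ≠ 0) (hmn : m ≤ n) :
    poch a m ≠ 0 := by
  rw [poch_split a hmn] at h
  exact left_ne_zero_of_mul h

theorem poch_shift_ne_zero {a : ℝ} {k m n : ℕ} (h : poch a n ≠ 0) (hkm : k + m ≤ n) :
    poch (a + k) m ≠ 0 := by
  have := poch_ne_zero_of_le h hkm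
  rw [poch_add] at this
  exact right_ne_zero_of_mul this

theorem poch_factor_ne_zero {a : ℝ} {k n : ℕ} (h : poch a n ≠ 0) (hk : k < n) :
    a + k ≠ 0 := by
  have := poch_shift_ne_zero (k := k) (m := 1) h hk
  rwa [poch_one] at this

/-- Reflection of the rising factorial. -/
theorem poch_reflect (a : ℝ) (n : ℕ) : poch (1 - a - n) n = (-1) ^ n * poch a n := by
  have h1 : (-1 : ℝ) ^ n = ∏ _i ∈ Finset.range n, (-1 : ℝ) := by simp
  rw [poch_eq_prod, poch_eq_prod, ← Finset.prod_range_reflect, h1, ← Finset.prod_mul_distrib]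
  refine Finset.prod_congr rfl fun i hi => ?_
  have hi := Finset.mem_range.mp hi
  rw [Nat.cast_sub (by omega), Nat.cast_sub (by omega)]
  push_cast
  ring

theorem poch_reflect' {a b : ℝ} {n : ℕ} (h : a + b + n = 1) :
    poch b n = (-1) ^ n * poch a n := by
  rw [← poch_reflect]
  congr 1
  linarith

theorem poch_neg_of_lt {m k : ℕ} (h : m < k) : poch (-(m : ℝ)) k = 0 := by
  rw [poch_eq_prod]
  exact Finset.prod_eq_zero (Finset.mem_range.mpr h) (by simp)

theorem poch_neg_mul_factorial {m k : ℕ} (h : k ≤ m) :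
    poch (-(m : ℝ)) k * ((m - k).factorial : ℝ) = (-1) ^ k * m.factorial := by
  induction k with
  | zero => simp
  | succ k ih =>
    have h1 := ih (by omega)
    rw [poch_succ, pow_succ, mul_comm ((-1 : ℝ) ^ k), mul_assoc (-1 : ℝ), ← h1,
      show m - k = (m - (k + 1)) + 1 by omega, Nat.factorial_succ]
    push_cast [Nat.cast_sub h]
    ring

theorem poch_neg_div_factorial {n k : ℕ} (h : k ≤ n) :
    poch (-(n : ℝ)) k / (k.factorial : ℝ) = (-1) ^ k * (n.choose k : ℝ) := by
  have h1 := poch_neg_mul_factorial h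
  have h2 : ((n - k).factorial : ℝ) ≠ 0 := by positivity
  have h3 : (k.factorial : ℝ) ≠ 0 := by positivity
  rw [Nat.cast_choose ℝ h, div_eq_iff h3]
  field_simp
  linarith

/-! ### Summation and transformation of terminating series. -/

/-- The Pfaff–Saalschütz summation in polynomial form. -/
theorem saalschuetz (n : ℕ) (a b e : ℝ) :
    ∑ k ∈ Finset.range (n + 1), (n.choose k : ℝ) * poch a k * poch b k * poch e (n - k)
        * poch (a + b + e + k) (n - k)
      = poch (b + e) n * poch (a + e) n := by
  induction n with
  | zero => simp
  | succ n ih =>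
    set t : ℕ → ℝ := fun k => (n.choose k : ℝ) * poch a k * poch b k * poch e (n - k)
        * poch (a + b + e + k) (n - k) with ht
    -- Telescoping certificate: the summand for n + 1 is (a+e+n)(b+e+n) times the summand for n, up
    -- to a difference of consecutive values of `W`.
    set W : ℕ → ℝ := fun k => t k * ((a + k) * (b + k)) with hW
    have hstep : ∀ k ∈ Finset.range (n + 1),
        ((n + 1).choose (k + 1) : ℝ) * poch a (k + 1) * poch b (k + 1)
          * poch e (n + 1 - (k + 1)) * poch (a + b + e + (k + 1 : ℕ)) (n + 1 - (k + 1))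
        = (a + e + n) * (b + e + n) * t (k + 1) - W (k + 1) + W k := by
      intro k hk
      rcases Nat.lt_or_ge k n with hkn | hkn
      · obtain ⟨p, rfl⟩ : ∃ p, n = k + 1 + p := ⟨n - (k + 1), by omega⟩
        have hc : ((k + 1 + p).choose k : ℝ) * (p + 1)
            = ((k + 1 + p).choose (k + 1) : ℝ) * (k + 1) := by
          have := Nat.choose_succ_right_eq (k + 1 + p) k
          rw [show k + 1 + p - k = p + 1 by omega] at this
          exact_mod_cast this.symm
        simp only [hW, ht]
        rw [Nat.choose_succ_succ', show k + 1 + p + 1 - (k + 1) = p + 1 by omega,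
          show k + 1 + p - (k + 1) = p by omega, show k + 1 + p - k = p + 1 by omega,
          poch_succ_left (a + b + e + (k : ℕ)) p, poch_succ (a + b + e + (k + 1 : ℕ)) p,
          show a + b + e + (k : ℝ) + 1 = a + b + e + ((k + 1 : ℕ) : ℝ) by push_cast; ring,
          poch_succ a k, poch_succ b k, poch_succ e p]
        push_cast
        linear_combination (poch a k * (a + k) * (poch b k * (b + k)) * (poch e p * (e + p))
          * poch (a + b + e + (k + 1 : ℝ)) p) * hc
      · obtain rfl : k = n := by have := Finset.mem_range.mp hk; omega
        simp [hW, ht, poch_succ, Nat.choose_succ_self]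
        ring
    have h0 : ((n + 1).choose 0 : ℝ) * poch a 0 * poch b 0 * poch e (n + 1 - 0)
          * poch (a + b + e + (0 : ℕ)) (n + 1 - 0)
        = (a + e + n) * (b + e + n) * t 0 - W 0 := by
      simp [hW, ht, poch_succ]
      ring
    have hlast : t (n + 1) = 0 := by simp [ht, Nat.choose_succ_self]
    rw [Finset.sum_range_succ', Finset.sum_congr rfl hstep, h0]
    have e1 : ∑ k ∈ Finset.range (n + 1), W (k + 1) + W 0
        = ∑ k ∈ Finset.range (n + 1), W k := by
      rw [← Finset.sum_range_succ', Finset.sum_range_succ]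
      simp [hW, hlast]
    have e2 : ∑ k ∈ Finset.range (n + 1), t (k + 1) + t 0
        = ∑ k ∈ Finset.range (n + 1), t k := by
      rw [← Finset.sum_range_succ', Finset.sum_range_succ, hlast, add_zero]
    rw [Finset.sum_add_distrib, Finset.sum_sub_distrib, ← Finset.mul_sum, poch_succ, poch_succ]
    linear_combination (a + e + n) * (b + e + n) * (e2 + ih) - e1

/-- The Pfaff–Saalschütz summation in the normalization of `clearedHyp43`. -/
theorem saalschuetz_cleared (n : ℕ) {a b c f : ℝ} (h : c + f + n = 1 + a + b) :
    ∑ k ∈ Finset.range (n + 1), poch (-(n : ℝ)) k * poch a k * poch b k / (k.factorial : ℝ)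
        * (poch (c + k) (n - k) * poch (f + k) (n - k))
      = (-1) ^ n * (poch (c - a) n * poch (c - b) n) := by
  have := saalschuetz n a b (c - a - b)
  rw [show b + (c - a - b) = c - a by ring, show a + (c - a - b) = c - b by ring] at this
  rw [← this, Finset.mul_sum]
  refine Finset.sum_congr rfl fun k hk => ?_
  have hkn : k ≤ n := Nat.lt_succ_iff.mp (Finset.mem_range.mp hk)
  have h1 := poch_neg_div_factorial hkn
  have h2 : poch (f + k) (n - k) = (-1) ^ (n - k) * poch (c - a - b) (n - k) :=
    poch_reflect' (by push_cast [Nat.cast_sub hkn]; linarith)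
  have h3 : (-1 : ℝ) ^ n = (-1) ^ k * (-1) ^ (n - k) := by
    rw [← pow_add, Nat.add_sub_cancel' hkn]
  rw [h2, h3, show a + b + (c - a - b) + (k : ℝ) = c + k by ring]
  linear_combination (poch a k * poch b k * poch (c + k) (n - k)
    * ((-1) ^ (n - k) * poch (c - a - b) (n - k))) * h1

/-- The Sears–Whipple transformation of a balanced terminating `₄F₃`, in polynomial form. -/
theorem sears (n : ℕ) {a b c u v w : ℝ} (h : u + v + w + n = a + b + c + 1) :
    clearedHyp43 n a b c u v w
      = clearedHyp43 n a (w - b) (w - c) (a - n + 1 - u) (a - n + 1 - v) w := by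
  -- Saalschütz read backwards, with parameters chosen so that its right side is (b)_k (c)_k.
  have hbc : ∀ k, poch b k * poch c k = ∑ j ∈ Finset.range (k + 1), (k.choose j : ℝ)
      * poch (w - b) j * poch (w - c) j * poch (b + c - w) (k - j) * poch (w + j) (k - j) := by
    intro k
    have := saalschuetz k (w - b) (w - c) (b + c - w)
    rw [show w - c + (b + c - w) = b by ring, show w - b + (b + c - w) = c by ring,
      show w - b + (w - c) + (b + c - w) = w by ring] at this
    exact this.symm
  unfold clearedHyp43
  have h1 : ∀ k ∈ Finset.range (n + 1),
      poch (-(n : ℝ)) k * poch a k * poch b k * poch c k / (k.factorial : ℝ)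
        * (poch (u + k) (n - k) * poch (v + k) (n - k) * poch (w + k) (n - k))
      = ∑ j ∈ Finset.range (k + 1), poch (-(n : ℝ)) j * poch a j * poch (w - b) j
        * poch (w - c) j / (j.factorial : ℝ) * poch (w + j) (n - j)
        * (poch (-((n - j : ℕ) : ℝ)) (k - j) * poch (a + j) (k - j) * poch (b + c - w) (k - j)
            / ((k - j).factorial : ℝ)
          * (poch (u + j + (k - j : ℕ)) (n - j - (k - j))
            * poch (v + j + (k - j : ℕ)) (n - j - (k - j)))) := by
    intro k hk
    have hkn : k ≤ n := Nat.lt_succ_iff.mp (Finset.mem_range.mp hk)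
    rw [mul_assoc (_ * _) (poch b k), hbc, Finset.mul_sum, Finset.sum_div, Finset.sum_mul]
    refine Finset.sum_congr rfl fun j hj => ?_
    have hjk : j ≤ k := Nat.lt_succ_iff.mp (Finset.mem_range.mp hj)
    obtain ⟨i, rfl⟩ : ∃ i, k = j + i := ⟨k - j, by omega⟩
    obtain ⟨p, rfl⟩ : ∃ p, n = j + i + p := ⟨n - (j + i), by omega⟩
    have hc : ((j + i).choose j : ℝ) * ((j + i).factorial : ℝ)⁻¹
        = (j.factorial : ℝ)⁻¹ * (i.factorial : ℝ)⁻¹ := by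
      have f3 : ((j + i).factorial : ℝ) ≠ 0 := by positivity
      rw [Nat.cast_choose ℝ hjk, Nat.add_sub_cancel_left]
      field_simp
    rw [show j + i - j = i by omega, show j + i + p - (j + i) = p by omega,
      show j + i + p - j = i + p by omega, show i + p - i = p by omega,
      poch_add _ j i, poch_add a j i, poch_add (w + j) i p,
      show -((j + i + p : ℕ) : ℝ) + j = -((i + p : ℕ) : ℝ) by push_cast; ring,
      show u + (j : ℝ) + i = u + (j + i : ℕ) by push_cast; ring,
      show v + (j : ℝ) + i = v + (j + i : ℕ) by push_cast; ring,
      show w + (j : ℝ) + i = w + (j + i : ℕ) by push_cast; ring]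
    simp only [div_eq_mul_inv]
    linear_combination (poch (-((j + i + p : ℕ) : ℝ)) j * poch (-((i + p : ℕ) : ℝ)) i
      * (poch a j * poch (a + j) i) * poch (w - b) j * poch (w - c) j * poch (b + c - w) i
      * poch (w + j) i * (poch (u + (j + i : ℕ)) p * poch (v + (j + i : ℕ)) p
      * poch (w + (j + i : ℕ)) p)) * hc
  rw [Finset.sum_congr rfl h1]
  -- After exchanging the sums, the inner one is again of Saalschütz type; this is where the
  -- balancing condition enters.
  rw [Finset.sum_range_diag_flip (n + 1) fun j i => poch (-(n : ℝ)) j * poch a j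
    * poch (w - b) j * poch (w - c) j / (j.factorial : ℝ) * poch (w + j) (n - j)
    * (poch (-((n - j : ℕ) : ℝ)) i * poch (a + j) i * poch (b + c - w) i / (i.factorial : ℝ)
      * (poch (u + j + i) (n - j - i) * poch (v + j + i) (n - j - i)))]
  refine Finset.sum_congr rfl fun j hj => ?_
  have hjn : j ≤ n := Nat.lt_succ_iff.mp (Finset.mem_range.mp hj)
  rw [← Finset.mul_sum, Nat.sub_add_comm hjn, saalschuetz_cleared (n - j) (by push_cast [Nat.cast_sub hjn]; linarith),
    show u + (j : ℝ) - (b + c - w) = a - n + 1 - v + j by linarith,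
    show u + (j : ℝ) - (a + j) = u - a by ring,
    poch_reflect' (a := u - a) (b := a - n + 1 - u + j)
      (by push_cast [Nat.cast_sub hjn]; linarith)]
  ring

/-- Uncleared, both sides carry one and the same ₄F₃, with upper parameters -n, -m, A, B; the
prefactors compensate for the different clearings. Terms beyond min(m, n) vanish. -/
theorem clearedHyp43_swap (m n : ℕ) (A B u v w : ℝ) :
    poch u m * poch v m * poch w m * clearedHyp43 n A (-(m : ℝ)) B u v w
      = poch u n * poch v n * poch w n * clearedHyp43 m B (-(n : ℝ)) A u v w := by
  have key : ∀ (m n : ℕ) (A B : ℝ), m ≤ n →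
      poch u m * poch v m * poch w m * clearedHyp43 n A (-(m : ℝ)) B u v w
        = poch u n * poch v n * poch w n * clearedHyp43 m B (-(n : ℝ)) A u v w := by
    intro m n A B hmn
    unfold clearedHyp43
    rw [Finset.mul_sum, Finset.mul_sum]
    symm
    apply Finset.sum_subset_zero_on_sdiff
    · intro k hk
      simp only [Finset.mem_range] at hk ⊢
      omega
    · intro k hk
      simp only [Finset.mem_sdiff, Finset.mem_range] at hk
      rw [poch_neg_of_lt (m := m) (k := k) (by omega)]
      ring
    · intro k hk
      have hk : k ≤ m := Nat.lt_succ_iff.mp (Finset.mem_range.mp hk)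
      have hkn := hk.trans hmn
      rw [poch_split u hk, poch_split v hk, poch_split w hk, poch_split u hkn,
        poch_split v hkn, poch_split w hkn]
      ring
  rcases le_total m n with h | h
  · exact key m n A B h
  · exact (key n m B A h).symm

/-! ### Duality in one variable. -/

/-- The univariate (cleared) Racah polynomial with parameters `b0, b1, b2`. -/
noncomputable def racahOne (b0 b1 b2 N : ℝ) (n : ℕ) (x : ℝ) : ℝ :=
  clearedHyp43 n (n + b2 - b0 - 1) (-x) (b1 + x) (b1 - b0) (b2 + N) (-N)

/-- Duality of the univariate Racah polynomials under `(n, x) ↦ (N - x, N - n)`. -/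
theorem racahOne_dual (b0 b1 b2 N : ℝ) (n m : ℕ) :
    poch (b2 - b1) m * poch (-b0 - N) m * poch (-N) m * racahOne b0 b1 b2 N n (N - m)
      = poch (b2 - b1) n * poch (-b0 - N) n * poch (-N) n
        * racahOne b0 (b0 - b2 - 2 * N + 1) (b0 - b1 - 2 * N + 1) N m (N - n) := by
  unfold racahOne
  -- Both series now have lower parameters b2 - b1, -b0 - N, -N, and the pairs (n, A), (m, B) have
  -- exchanged roles.
  rw [sears n (by ring), sears m (by ring)]
  have := clearedHyp43_swap m n (n + b2 - b0 - 1) (-N - b1 - N + m) (b2 - b1) (-b0 - N) (-N)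
  convert this using 3 <;> ring

theorem poch_neg_eq {N m : ℕ} (h : m ≤ N) :
    poch (-(N : ℝ)) m = (-1) ^ m * N.factorial / (N - m).factorial := by
  have h1 : ((N - m).factorial : ℝ) ≠ 0 := by positivity
  rw [eq_div_iff h1, poch_neg_mul_factorial h]

/-- `racahOne_dual` with m = N - x. Reversing (-b0-N)_k (-N)_k splits off a factor independent of k,
which cancels; the remaining denominators are those that telescope in several variables. -/
theorem racahOne_dual_nat {b0 : ℝ} (hb0 : -1 < b0) (b1 b2 : ℝ) {N n x : ℕ} (hn : n ≤ N)
    (hx : x ≤ N) :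
    poch (b2 - b1) (N - x) / (x.factorial * poch (b0 + 1) x) * racahOne b0 b1 b2 N n x
      = poch (b2 - b1) n / ((N - n).factorial * poch (b0 + 1) (N - n))
        * racahOne b0 (b0 - b2 - 2 * N + 1) (b0 - b1 - 2 * N + 1) N (N - x) (N - n : ℕ) := by
  have aux : ∀ k ≤ N, poch (-b0 - N) k * poch (-(N : ℝ)) k
      = poch (b0 + 1) N * N.factorial / ((N - k).factorial * poch (b0 + 1) (N - k)) := by
    intro k hk
    have h1 : poch (-b0 - N) k = (-1) ^ k * poch (b0 + 1 + (N - k : ℕ)) k :=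
      poch_reflect' (by push_cast [Nat.cast_sub hk]; ring)
    have h2 : poch (b0 + 1) N = poch (b0 + 1) (N - k) * poch (b0 + 1 + (N - k : ℕ)) k := by
      rw [← poch_add, Nat.sub_add_cancel hk]
    have h3 : poch (b0 + 1) (N - k) ≠ 0 := (poch_pos (by linarith) _).ne'
    have h4 : ((-1 : ℝ) ^ k) * (-1) ^ k = 1 := by rw [← mul_pow]; simp
    rw [poch_neg_eq hk, h1, h2]
    field_simp
    linear_combination (poch (b0 + 1 + (N - k : ℕ)) k) * h4
  have h := racahOne_dual b0 b1 b2 N n (N - x)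
  rw [mul_assoc (poch (b2 - b1) (N - x)), aux _ (Nat.sub_le N x), mul_assoc (poch (b2 - b1) n),
    aux _ hn, Nat.sub_sub_self hx, Nat.cast_sub hx, sub_sub_cancel, ← Nat.cast_sub hn] at h
  have h1 : poch (b0 + 1) N ≠ 0 := (poch_pos (by linarith) _).ne'
  have h2 : (N.factorial : ℝ) ≠ 0 := by positivity
  apply mul_left_cancel₀ (mul_ne_zero h1 h2)
  linear_combination h

/-! ### Divided differences and the norm in one variable. -/

/-- The divided difference of order M ≥ 1 of the constant 1 at the nodes i(c + i). The partial sums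
have a closed form, given in `key`, found by indefinite summation. -/
theorem telescoping_inverse (M : ℕ) (hM : 1 ≤ M) (c : ℝ) (hc : poch c (2 * M + 1) ≠ 0) :
    ∑ i ∈ Finset.range (M + 1), (-1) ^ i * (c + 2 * i)
      / (poch (c + i) (M + 1) * i.factorial * (M - i).factorial) = 0 := by
  have hne : ∀ i ≤ M, poch (c + i) (M + 1) ≠ 0 := fun i hi =>
    poch_shift_ne_zero hc (by omega)
  have key : ∀ I ≤ M, ∑ i ∈ Finset.range I, (-1) ^ i * (c + 2 * i)
      / (poch (c + i) (M + 1) * i.factorial * (M - i).factorial)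
      = -((-1) ^ I * I * (c + I + M)
          / (M * poch (c + I) (M + 1) * I.factorial * (M - I).factorial)) := by
    intro I hI
    have hM0 : (M : ℝ) ≠ 0 := by positivity
    induction I with
    | zero => simp
    | succ I ih =>
      obtain ⟨p, rfl⟩ : ∃ p, M = I + 1 + p := ⟨M - (I + 1), by omega⟩
      rw [Finset.sum_range_succ, ih (by omega)]
      have h1 := hne I (by omega)
      have h2 := hne (I + 1) hI
      have e1 : poch (c + I) (I + 1 + p + 1)
          = (c + I) * poch (c + (I + 1 : ℕ)) (I + 1 + p) := by
        rw [poch_succ_left]; push_cast; ring_nf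
      have e2 : poch (c + (I + 1 : ℕ)) (I + 1 + p + 1)
          = poch (c + (I + 1 : ℕ)) (I + 1 + p) * (c + (I + 1 : ℕ) + (I + 1 + p : ℕ)) :=
        poch_succ _ _
      rw [e1] at h1 ⊢
      rw [e2] at h2 ⊢
      have h3 := left_ne_zero_of_mul h1
      have h4 := left_ne_zero_of_mul h2
      have h5 := right_ne_zero_of_mul h2
      rw [show I + 1 + p - I = p + 1 by omega, show I + 1 + p - (I + 1) = p by omega,
        Nat.factorial_succ, Nat.factorial_succ, pow_succ]
      generalize poch (c + (I + 1 : ℕ)) (I + 1 + p) = Q at *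
      have f1 : (I.factorial : ℝ) ≠ 0 := by positivity
      have f2 : (p.factorial : ℝ) ≠ 0 := by positivity
      have f3 : (p : ℝ) + 1 ≠ 0 := by positivity
      have f4 : (I : ℝ) + 1 ≠ 0 := by positivity
      push_cast at *
      field_simp
      ring
  rw [Finset.sum_range_succ, key M le_rfl]
  have h1 := hne M le_rfl
  have hM0 : (M : ℝ) ≠ 0 := by positivity
  have f1 : (M.factorial : ℝ) ≠ 0 := by positivity
  simp only [Nat.sub_self, Nat.factorial_zero, Nat.cast_one]
  field_simp
  ring

/-- The divided difference of order `L` at the nodes `x (c + x)`, `0 ≤ x ≤ L`, of the Newton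
basis polynomial `(-x)_k (c + x)_k`. -/
theorem sum_divided_difference (L k : ℕ) (hk : k ≤ L) (c : ℝ) (hc : poch c (2 * L + 1) ≠ 0) :
    ∑ x ∈ Finset.range (L + 1), (-1) ^ (L - x) * (c + 2 * x)
      / (poch (c + x) (L + 1) * x.factorial * (L - x).factorial)
      * (poch (-(x : ℝ)) k * poch (c + x) k) = if k = L then (-1) ^ L else 0 := by
  obtain ⟨M, rfl⟩ : ∃ M, L = k + M := ⟨L - k, by omega⟩
  rw [show k + M + 1 = k + (M + 1) by ring, Finset.sum_range_add]
  have h0 : ∑ x ∈ Finset.range k, (-1) ^ (k + M - x) * (c + 2 * x)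
      / (poch (c + x) (k + (M + 1)) * x.factorial * (k + M - x).factorial)
      * (poch (-(x : ℝ)) k * poch (c + x) k) = 0 := by
    refine Finset.sum_eq_zero fun x hx => ?_
    rw [poch_neg_of_lt (Finset.mem_range.mp hx)]
    ring
  have h1 : ∀ i ∈ Finset.range (M + 1), (-1 : ℝ) ^ (k + M - (k + i)) * (c + 2 * (k + i : ℕ))
      / (poch (c + (k + i : ℕ)) (k + (M + 1)) * (k + i).factorial * (k + M - (k + i)).factorial)
      * (poch (-((k + i : ℕ) : ℝ)) k * poch (c + (k + i : ℕ)) k)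
      = (-1) ^ (k + M) * ((-1) ^ i * (c + 2 * k + 2 * i)
      / (poch (c + 2 * k + i) (M + 1) * i.factorial * (M - i).factorial)) := by
    intro i hi
    have hi : i ≤ M := Nat.lt_succ_iff.mp (Finset.mem_range.mp hi)
    have e1 := poch_add (c + (k + i : ℕ)) k (M + 1)
    have n1 : poch (c + (k + i : ℕ)) (k + (M + 1)) ≠ 0 := poch_shift_ne_zero hc (by omega)
    rw [e1] at n1 ⊢
    have n2 := left_ne_zero_of_mul n1
    have n3 := right_ne_zero_of_mul n1
    have e3 : poch (-((k + i : ℕ) : ℝ)) k = (-1) ^ k * (k + i).factorial / i.factorial := by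
      rw [poch_neg_eq (Nat.le_add_right k i), Nat.add_sub_cancel_left]
    have e4 : c + ((k + i : ℕ) : ℝ) + k = c + 2 * k + i := by push_cast; ring
    rw [e3, show k + M - (k + i) = M - i by omega]
    rw [e4] at n3 ⊢
    have e5 : (-1 : ℝ) ^ (k + M) * (-1) ^ i = (-1) ^ (M - i) * (-1) ^ k := by
      obtain ⟨p, rfl⟩ : ∃ p, M = i + p := ⟨M - i, by omega⟩
      rw [Nat.add_sub_cancel_left, pow_add, pow_add]
      have : (-1 : ℝ) ^ i * (-1) ^ i = 1 := by rw [← mul_pow]; simp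
      linear_combination ((-1) ^ k * (-1) ^ p : ℝ) * this
    have f1 : (i.factorial : ℝ) ≠ 0 := by positivity
    have f2 : ((k + i).factorial : ℝ) ≠ 0 := by positivity
    have f3 : ((M - i).factorial : ℝ) ≠ 0 := by positivity
    push_cast at *
    field_simp
    linear_combination (-(c + 2 * (k + i))) * e5
  rw [h0, Finset.sum_congr rfl h1, ← Finset.mul_sum, zero_add]
  rcases Nat.eq_zero_or_pos M with rfl | hM
  · have h2 : c + 2 * (k : ℝ) ≠ 0 := by
      have := poch_factor_ne_zero (k := 2 * k) hc (by omega)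
      push_cast at this; exact this
    simp [poch_one, h2]
  · rw [if_neg (by omega), telescoping_inverse M hM, mul_zero]
    have := poch_shift_ne_zero (k := 2 * k) (m := 2 * M + 1) hc (by omega)
    push_cast at this
    exact this

theorem neg_one_pow_mul_self (k : ℕ) : ((-1 : ℝ) ^ k) * (-1) ^ k = 1 := by
  rw [← mul_pow]; simp

/-- The kernel of the divided difference of order `L` at the nodes `x (c + x)`. -/
noncomputable def dividedKernel (c : ℝ) (L x : ℕ) : ℝ :=
  (-1) ^ (L - x) * (c + 2 * x) / (poch (c + x) (L + 1) * x.factorial * (L - x).factorial)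

/-- A Rodrigues-type formula: each term of the dual series, multiplied by this part of the weight,
is a constant times a divided-difference kernel of order N - l. The factor (-(N-n))_l removes the
orders below n. -/
theorem racahOne_dual_expansion (b0 b1 b2 : ℝ) {N n x : ℕ} (hn : n ≤ N) (hx : x ≤ N)
    (h1 : poch b1 (2 * N + 1) ≠ 0) :
    poch (b1 - b0) x * poch b1 x * ((b1 + 2 * x) / b1) * poch b2 (N + x)
        / ((N - x).factorial * poch (b1 + 1) (N + x))
      * racahOne b0 (b0 - b2 - 2 * N + 1) (b0 - b1 - 2 * N + 1) N (N - x) (N - n : ℕ)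
    = ∑ l ∈ Finset.range (N - x + 1),
        (poch (b1 - b0) (N - l) * poch b2 (2 * N - l) * (N - l).factorial
          * poch (-((N - n : ℕ) : ℝ)) l * poch (b0 - b2 - N - n + 1) l / l.factorial)
        * dividedKernel b1 (N - l) x := by
  unfold racahOne clearedHyp43 dividedKernel
  rw [Finset.mul_sum]
  refine Finset.sum_congr rfl fun l hl => ?_
  have hl : l ≤ N - x := Nat.lt_succ_iff.mp (Finset.mem_range.mp hl)
  obtain ⟨p, rfl⟩ : ∃ p, N = x + (l + p) := ⟨N - x - l, by omega⟩
  have a1 : x + (l + p) - x = l + p := by omega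
  have a2 : x + (l + p) - l = x + p := by omega
  have a3 : 2 * (x + (l + p)) - l = x + (l + p) + x + p := by omega
  have a4 : l + p - l = p := by omega
  have a5 : x + p - x = p := by omega
  rw [a1, a2, a3, a4, a5]
  set M := x + (l + p) with hM
  have hMr : (M : ℝ) = x + (l + p) := by rw [hM]; push_cast; ring
  have e1 : poch (b0 - b2 - 2 * (M : ℝ) + 1 - b0 + l) p = (-1) ^ p * poch (b2 + (M + x : ℕ)) p :=
    poch_reflect' (by push_cast; rw [hMr]; ring)
  have e2 : poch (b0 - b1 - 2 * (M : ℝ) + 1 + M + l) p = (-1) ^ p * poch (b1 - b0 + x) p :=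
    poch_reflect' (by rw [hMr]; ring)
  have e3 : poch (-(M : ℝ) + l) p = (-1) ^ p * (x + p).factorial / x.factorial := by
    rw [show -(M : ℝ) + l = -((x + p : ℕ) : ℝ) by push_cast; rw [hMr]; ring,
      poch_neg_eq (Nat.le_add_left p x), Nat.add_sub_cancel]
  have e4 : poch (-((l + p : ℕ) : ℝ)) l = (-1) ^ l * (l + p).factorial / p.factorial := by
    rw [poch_neg_eq (Nat.le_add_right l p), Nat.add_sub_cancel_left]
  have e5 : poch (((l + p : ℕ) : ℝ) + (b0 - b1 - 2 * (M : ℝ) + 1) - b0 - 1) l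
      = (-1) ^ l * poch (b1 + 1 + (x + p + x : ℕ)) l :=
    poch_reflect' (by push_cast; rw [hMr]; ring)
  have e6 : b0 - b2 - 2 * (M : ℝ) + 1 + ((M - n : ℕ) : ℝ) = b0 - b2 - M - n + 1 := by
    rw [Nat.cast_sub hn]; ring
  have e7 : poch b2 (M + x + p) = poch b2 (M + x) * poch (b2 + (M + x : ℕ)) p := poch_add _ _ _
  have e8 : poch (b1 - b0) (x + p) = poch (b1 - b0) x * poch (b1 - b0 + x) p := poch_add _ _ _
  have e9 : poch (b1 + 1) (M + x) = poch (b1 + 1) (x + p + x) * poch (b1 + 1 + (x + p + x : ℕ)) l := by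
    rw [← poch_add]; congr 1; omega
  have e10 : b1 * poch (b1 + 1) (x + p + x) = poch b1 x * poch (b1 + x) (x + p + 1) := by
    rw [← poch_add, ← poch_succ_left]; congr 1; omega
  have n0 : b1 ≠ 0 := by
    have := poch_factor_ne_zero (k := 0) h1 (by omega)
    simpa using this
  have n1 : poch (b1 + 1) (M + x) ≠ 0 := by
    have := poch_ne_zero_of_le h1 (m := M + x + 1) (by omega)
    rw [poch_succ_left] at this
    exact right_ne_zero_of_mul this
  have n2 : poch (b1 + x) (x + p + 1) ≠ 0 := poch_shift_ne_zero h1 (by omega)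
  rw [e1, e2, e3, e4, e5, e6, e7, e8]
  rw [e9] at n1 ⊢
  have n3 := left_ne_zero_of_mul n1
  have n4 := right_ne_zero_of_mul n1
  have f1 : (x.factorial : ℝ) ≠ 0 := by positivity
  have f2 : (l.factorial : ℝ) ≠ 0 := by positivity
  have f3 : (p.factorial : ℝ) ≠ 0 := by positivity
  have f4 : ((l + p).factorial : ℝ) ≠ 0 := by positivity
  have s1 := neg_one_pow_mul_self l
  have s2 := neg_one_pow_mul_self p
  have hq : poch b1 x = b1 * poch (b1 + 1) (x + p + x) / poch (b1 + x) (x + p + 1) := by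
    field_simp; exact e10.symm
  rw [hq]
  -- With the Pochhammer symbols and factorials abstracted to scalars, only cancellations remain,
  -- and the signs occur squared except for one (-1)^p, the sign of the kernel.
  have alg : ∀ A A' B B' C D q1 q2 q3 b c u v lp l' p' x' xp : ℝ, b ≠ 0 → q1 ≠ 0 → q2 ≠ 0 →
      lp ≠ 0 → u * u = 1 → v * v = 1 →
      A * (b * q2 / q3) * (c / b) * B / (lp * (q2 * q1))
        * (u * lp / p' * (u * q1) * C * D / l' * (v * B' * (v * A') * (v * xp / x')))
      = A * A' * (B * B') * xp * C * D / l' * (v * c / (q3 * x' * p')) := by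
    intro A A' B B' C D q1 q2 q3 b c u v lp l' p' x' xp hb hq1 hq2 hlp hu hv
    have e : A * (b * q2 / q3) * (c / b) * B / (lp * (q2 * q1))
        * (u * lp / p' * (u * q1) * C * D / l' * (v * B' * (v * A') * (v * xp / x')))
        = (u * u) * (v * v) * (b * b⁻¹) * (q1 * q1⁻¹) * (q2 * q2⁻¹) * (lp * lp⁻¹)
          * (A * A' * (B * B') * xp * C * D / l' * (v * c / (q3 * x' * p'))) := by
      simp only [div_eq_mul_inv, mul_inv]
      ring
    rw [e, hu, hv, mul_inv_cancel₀ hb, mul_inv_cancel₀ hq1, mul_inv_cancel₀ hq2,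
      mul_inv_cancel₀ hlp]
    ring
  exact alg _ _ _ _ _ _ _ _ _ _ _ _ _ _ _ _ _ _ n0 n4 n3 f4 s1 s2

/-- The norm of the univariate Racah polynomial. -/
theorem racahOne_norm {b0 : ℝ} (hb0 : -1 < b0) (b1 b2 : ℝ) {N n : ℕ} (hn : n ≤ N)
    (h1 : poch b1 (2 * N + 1) ≠ 0) :
    ∑ x ∈ Finset.range (N + 1), poch (b1 - b0) x * poch b1 x / (x.factorial * poch (b0 + 1) x)
      * ((b1 + 2 * x) / b1)
      * (poch (b2 - b1) (N - x) * poch b2 (N + x)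
          / ((N - x).factorial * poch (b1 + 1) (N + x)))
      * racahOne b0 b1 b2 N n x ^ 2
    = n.factorial * poch (b2 - b1) n * poch (b1 - b0) n * poch (n + b2 - b0 - 1) n
      * (poch b2 (N + n) * poch (b2 + 2 * n - b0) (N - n)
          / ((N - n).factorial * poch (b0 + 1) (N - n))) := by
  set E := poch (b2 - b1) n / ((N - n).factorial * poch (b0 + 1) (N - n)) with hE
  set c : ℕ → ℝ := fun l => poch (b1 - b0) (N - l) * poch b2 (2 * N - l) * (N - l).factorial
          * poch (-((N - n : ℕ) : ℝ)) l * poch (b0 - b2 - N - n + 1) l / l.factorial with hc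
  set r : ℕ → ℝ := fun k => poch (-(n : ℝ)) k * poch (n + b2 - b0 - 1) k / (k.factorial : ℝ)
      * (poch (b1 - b0 + k) (n - k) * poch (b2 + N + k) (n - k) * poch (-(N : ℝ) + k) (n - k))
    with hr
  -- Duality is applied to one of the two factors of the square; the other is kept as a polynomial
  -- in x(b1 + x).
  have hA : ∀ x ∈ Finset.range (N + 1),
      poch (b1 - b0) x * poch b1 x / (x.factorial * poch (b0 + 1) x)
      * ((b1 + 2 * x) / b1)
      * (poch (b2 - b1) (N - x) * poch b2 (N + x)
          / ((N - x).factorial * poch (b1 + 1) (N + x)))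
      * racahOne b0 b1 b2 N n x ^ 2
      = ∑ l ∈ Finset.range (N + 1 - x), E * c l * (dividedKernel b1 (N - l) x
          * racahOne b0 b1 b2 N n x) := by
    intro x hx
    have hx : x ≤ N := Nat.lt_succ_iff.mp (Finset.mem_range.mp hx)
    have h2 := racahOne_dual_expansion b0 b1 b2 hn hx h1
    have h3 := racahOne_dual_nat hb0 b1 b2 hn hx
    rw [← hE] at h3
    simp only [mul_assoc E, ← mul_assoc (c _)]
    rw [← Finset.mul_sum, ← Finset.sum_mul, Nat.sub_add_comm hx, ← h2, ← mul_assoc E]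
    rw [show ∀ A B C D F G H : ℝ, A / B * C * (D * F / G) * H ^ 2
      = (A * C * F / G) * (D / B * H) * H by intros; simp only [div_eq_mul_inv]; ring, h3]
    ring
  have hB : ∀ x : ℕ, racahOne b0 b1 b2 N n x
      = ∑ k ∈ Finset.range (n + 1), r k * (poch (-(x : ℝ)) k * poch (b1 + x) k) := by
    intro x
    unfold racahOne clearedHyp43
    refine Finset.sum_congr rfl fun k _ => ?_
    simp only [hr, div_eq_mul_inv]
    ring
  rw [Finset.sum_congr rfl hA]
  have hswap : ∑ x ∈ Finset.range (N + 1), ∑ l ∈ Finset.range (N + 1 - x),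
        E * c l * (dividedKernel b1 (N - l) x * racahOne b0 b1 b2 N n x)
      = ∑ l ∈ Finset.range (N + 1), ∑ x ∈ Finset.range (N - l + 1),
        E * c l * (dividedKernel b1 (N - l) x * racahOne b0 b1 b2 N n x) := by
    apply Finset.sum_comm'
    intro x l
    simp only [Finset.mem_range]
    omega
  -- For l > N - n the coefficient `c l` vanishes; for l < N - n the order N - l exceeds the degree
  -- n. What survives is the leading coefficient `r n` times `c (N - n)`.
  rw [hswap, Finset.sum_eq_single (N - n)]
  · rw [← Finset.mul_sum, Nat.sub_sub_self hn]
    simp only [hB, Finset.mul_sum]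
    rw [Finset.sum_comm, Finset.sum_eq_single n]
    · have h2 := sum_divided_difference n n le_rfl b1 (poch_ne_zero_of_le h1 (by omega))
      simp only [dividedKernel, if_true] at h2 ⊢
      simp only [mul_left_comm _ (r n)]
      rw [← Finset.mul_sum, ← Finset.mul_sum, h2]
      have e1 : r n = (-1) ^ n * poch (n + b2 - b0 - 1) n := by
        have : poch (-(n : ℝ)) n = (-1) ^ n * n.factorial := by
          rw [poch_neg_eq le_rfl]; simp
        simp only [hr, Nat.sub_self, poch_zero, this]
        field_simp
      have e2 : c (N - n) = poch (b1 - b0) n * poch b2 (N + n) * n.factorial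
          * poch (b2 + 2 * n - b0) (N - n) := by
        have h3 : poch (-((N - n : ℕ) : ℝ)) (N - n) = (-1) ^ (N - n) * (N - n).factorial := by
          rw [poch_neg_eq le_rfl]; simp
        have h4 : poch (b0 - b2 - N - n + 1) (N - n)
            = (-1) ^ (N - n) * poch (b2 + 2 * n - b0) (N - n) :=
          poch_reflect' (by rw [Nat.cast_sub hn]; ring)
        simp only [hc]
        rw [h3, h4, Nat.sub_sub_self hn, show 2 * N - (N - n) = N + n by omega]
        have := neg_one_pow_mul_self (N - n)
        field_simp
        rw [sq, this, mul_one]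
      rw [e1, e2, hE]
      have := neg_one_pow_mul_self n
      simp only [div_eq_mul_inv]
      linear_combination (poch (b2 - b1) n * (((N - n).factorial : ℝ) * poch (b0 + 1) (N - n))⁻¹
        * (poch (b1 - b0) n * poch b2 (N + n) * n.factorial * poch (b2 + 2 * n - b0) (N - n))
        * poch (n + b2 - b0 - 1) n) * this
    · intro k hk hkn
      have hk : k ≤ n := Nat.lt_succ_iff.mp (Finset.mem_range.mp hk)
      have h2 := sum_divided_difference n k hk b1 (poch_ne_zero_of_le h1 (by omega))
      rw [if_neg hkn] at h2
      simp only [dividedKernel, mul_left_comm _ (r k)]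
      rw [← Finset.mul_sum, ← Finset.mul_sum, h2, mul_zero, mul_zero]
    · simp
  · intro l hl hln
    have hl : l ≤ N := Nat.lt_succ_iff.mp (Finset.mem_range.mp hl)
    rcases Nat.lt_or_ge (N - n) l with h | h
    · have : c l = 0 := by simp [hc, poch_neg_of_lt h]
      simp [this]
    · rw [← Finset.mul_sum]
      simp only [hB, Finset.mul_sum]
      rw [Finset.sum_comm]
      refine Finset.sum_eq_zero fun k hk => ?_
      have hk : k ≤ n := Nat.lt_succ_iff.mp (Finset.mem_range.mp hk)
      have h2 := sum_divided_difference (N - l) k (by omega) b1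
        (poch_ne_zero_of_le h1 (by omega))
      rw [if_neg (by omega)] at h2
      simp only [dividedKernel, mul_left_comm _ (r k)]
      rw [← Finset.mul_sum, ← Finset.mul_sum, h2, mul_zero, mul_zero]
  · intro h
    simp at h

/-! ### Sums over the simplex. -/

theorem mem_simplex {d N : ℕ} {y : Fin d → ℕ} :
    y ∈ simplex d N ↔ (∀ i, y i ≤ N) ∧ Monotone y := by
  simp [simplex]

@[simp] theorem node_zero {d : ℕ} (N : ℕ) (x : Fin d → ℕ) : node N x 0 = 0 := by simp [node]

theorem node_succ_of_lt {d : ℕ} (N : ℕ) (x : Fin d → ℕ) {i : ℕ} (h : i < d) :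
    node N x (i + 1) = x ⟨i, h⟩ := by simp [node, h]

theorem node_last {d : ℕ} (N : ℕ) (x : Fin d → ℕ) : node N x (d + 1) = N := by simp [node]

theorem entry_succ {d : ℕ} (ν : Fin d → ℕ) {i : ℕ} (h : i < d) :
    entry ν (i + 1) = ν ⟨i, h⟩ := by simp [entry, h]

@[simp] theorem partialSum_zero {d : ℕ} (ν : Fin d → ℕ) : partialSum ν 0 = 0 := by
  simp [partialSum]

theorem partialSum_succ {d : ℕ} (ν : Fin d → ℕ) (j : ℕ) :
    partialSum ν (j + 1) = partialSum ν j + entry ν (j + 1) := by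
  rw [partialSum, Finset.sum_Icc_succ_top (by omega)]
  rfl

theorem partialSum_mono {d : ℕ} (ν : Fin d → ℕ) : Monotone (partialSum ν) :=
  monotone_nat_of_le_succ fun j => by rw [partialSum_succ]; omega

theorem partialSum_eq_sum {d : ℕ} (ν : Fin d → ℕ) : partialSum ν d = ∑ i, ν i := by
  have h : ∀ j, partialSum ν j = ∑ i ∈ Finset.range j, entry ν (i + 1) := by
    intro j
    induction j with
    | zero => simp
    | succ j ih => rw [partialSum_succ, ih, Finset.sum_range_succ]
  rw [h, ← Fin.sum_univ_eq_sum_range (fun i => entry ν (i + 1))]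
  exact Finset.sum_congr rfl fun i _ => entry_succ ν i.2

theorem node_le_succ {d N : ℕ} {x : Fin d → ℕ} (hx : x ∈ simplex d N) {j : ℕ} (hj : j ≤ d) :
    node N x j ≤ node N x (j + 1) := by
  rw [mem_simplex] at hx
  rcases j with _ | i
  · simp
  · rw [node_succ_of_lt N x (i := i) hj]
    rcases Nat.lt_or_ge (i + 1) d with h | h
    · rw [node_succ_of_lt N x h]
      exact hx.2 (by simp)
    · obtain rfl : d = i + 1 := by omega
      rw [node_last]
      exact hx.1 _

theorem node_le {d N : ℕ} {x : Fin d → ℕ} (hx : x ∈ simplex d N) (j : ℕ) :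
    node N x j ≤ N := by
  rw [mem_simplex] at hx
  unfold node
  split_ifs
  · exact Nat.zero_le _
  · exact hx.1 _
  · exact le_rfl

theorem node_snoc {d : ℕ} (N z : ℕ) (y : Fin d → ℕ) {j : ℕ} (hj : j ≤ d + 1) :
    node N (Fin.snoc (α := fun _ => ℕ) y z) j = node z y j := by
  rcases j with _ | i
  · simp
  · rw [node_succ_of_lt N _ (i := i) (by omega)]
    rcases Nat.lt_or_ge i d with h | h
    · rw [node_succ_of_lt z y h]
      exact Fin.snoc_castSucc (α := fun _ => ℕ) z y ⟨i, h⟩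
    · obtain rfl : i = d := by omega
      rw [node_last]
      exact Fin.snoc_last (α := fun _ => ℕ) z y

theorem sum_simplex_succ (d N : ℕ) (f : (Fin (d + 1) → ℕ) → ℝ) :
    ∑ y ∈ simplex (d + 1) N, f y
      = ∑ z ∈ Finset.range (N + 1), ∑ y ∈ simplex d z, f (Fin.snoc y z) := by
  rw [Finset.sum_sigma']
  refine Finset.sum_bij' (fun y _ => ⟨y (Fin.last d), Fin.init y⟩)
    (fun p _ => Fin.snoc (α := fun _ => ℕ) p.2 p.1) ?_ ?_ ?_ ?_ ?_
  · intro y hy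
    rw [mem_simplex] at hy
    simp only [Finset.mem_sigma, Finset.mem_range, mem_simplex]
    exact ⟨Nat.lt_succ_of_le (hy.1 _), fun i => hy.2 (Fin.le_last _),
      fun i j hij => hy.2 (Fin.castSucc_le_castSucc_iff.mpr hij)⟩
  · rintro ⟨z, y⟩ hp
    simp only [Finset.mem_sigma, Finset.mem_range, mem_simplex] at hp
    obtain ⟨hz, hy, hm⟩ := hp
    rw [mem_simplex]
    constructor
    · intro i
      refine Fin.lastCases ?_ (fun i => ?_) i
      · simp only [Fin.snoc_last]; omega
      · simp only [Fin.snoc_castSucc]; have := hy i; omega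
    · intro i
      refine Fin.lastCases ?_ (fun i => ?_) i
      · intro j hj
        rw [Fin.last_le_iff.mp hj]
      · intro j
        refine Fin.lastCases ?_ (fun j => ?_) j
        · intro _
          simpa only [Fin.snoc_last, Fin.snoc_castSucc] using hy i
        · intro hij
          simpa only [Fin.snoc_castSucc] using hm (Fin.castSucc_le_castSucc_iff.mp hij)
  · intro y _
    exact Fin.snoc_init_self y
  · rintro ⟨z, y⟩ _
    simp
  · intro y _
    simp

/-- Iterated sums of products of transfer kernels. -/
noncomputable def chain (G : ℕ → ℕ → ℕ → ℝ) : ℕ → ℕ → ℝ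
  | 0, z => G 0 0 z
  | j + 1, z => ∑ y ∈ Finset.range (z + 1), chain G j y * G (j + 1) y z

/-- Transfer-matrix principle: a summand that couples only neighbours can be summed one coordinate
at a time, with the last coordinate as upper end of the smaller simplex. -/
theorem sum_simplex_prod (G : ℕ → ℕ → ℕ → ℝ) (d N : ℕ) :
    ∑ y ∈ simplex d N, ∏ j ∈ Finset.range (d + 1), G j (node N y j) (node N y (j + 1))
      = chain G d N := by
  induction d generalizing N with
  | zero =>
    have : simplex 0 N = {fun i => 0} := by
      ext y
      simp only [mem_simplex, Finset.mem_singleton]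
      exact ⟨fun _ => funext fun i => i.elim0, fun _ => ⟨fun i => i.elim0, fun i => i.elim0⟩⟩
    rw [this]
    simp [chain, node_last N (fun _ : Fin 0 => 0)]
  | succ d ih =>
    rw [sum_simplex_succ, chain]
    refine Finset.sum_congr rfl fun z _ => ?_
    rw [← ih z, Finset.sum_mul]
    refine Finset.sum_congr rfl fun y _ => ?_
    rw [Finset.prod_range_succ, node_last, node_snoc N z y le_rfl, node_last]
    congr 1
    refine Finset.prod_congr rfl fun j hj => ?_
    have hj := Finset.mem_range.mp hj
    rw [node_snoc N z y (by omega), node_snoc N z y (by omega)]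

/-! ### Factorization and the multivariable norm. -/

/-- The nearest-neighbour factor of the weight. -/
noncomputable def stepWeight (a b : ℝ) (y z : ℕ) : ℝ :=
  poch (b - a) (z - y) * poch b (z + y) / ((z - y).factorial * poch (a + 1) (z + y))

/-- The single-site factor of the weight. -/
noncomputable def siteWeight (b : ℝ) (y : ℕ) : ℝ := poch ((b + 2) / 2) y / poch (b / 2) y

/-- The factors of the multivariable Racah polynomial. -/
noncomputable def racahTerm (b0 b1 b2 : ℝ) (s n y z : ℕ) : ℝ :=
  clearedHyp43 n (n + 2 * s + b2 - b0 - 1) (s - y) (s + b1 + y) (2 * s + b1 - b0) (s + b2 + z)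
    (s - z)

theorem prod_Icc_one (d : ℕ) (f : ℕ → ℝ) :
    ∏ j ∈ Finset.Icc 1 d, f j = ∏ i ∈ Finset.range d, f (i + 1) := by
  induction d with
  | zero => simp
  | succ d ih => rw [Finset.prod_Icc_succ_top (by omega), ih, Finset.prod_range_succ]

theorem weight_eq {d : ℕ} (x : Fin d → ℕ) (β : ℕ → ℝ) (N : ℕ) :
    weight x β N = stepWeight (β 0) (β 1) 0 (node N x 1)
      * ∏ i ∈ Finset.range d, (siteWeight (β (i + 1)) (node N x (i + 1))
        * stepWeight (β (i + 1)) (β (i + 2)) (node N x (i + 1)) (node N x (i + 2))) := by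
  rw [weight, prod_Icc_one, Finset.prod_range_succ', Finset.prod_mul_distrib, node_zero]
  simp only [stepWeight, siteWeight, zero_add]
  ring

theorem racah_eq {d : ℕ} (ν x : Fin d → ℕ) (β : ℕ → ℝ) (N : ℕ) :
    racah ν x β N = ∏ i ∈ Finset.range d, racahTerm (β 0) (β (i + 1)) (β (i + 2))
      (partialSum ν i) (entry ν (i + 1)) (node N x (i + 1)) (node N x (i + 2)) := by
  rw [racah, prod_Icc_one]
  rfl

theorem racahTerm_eq (b0 b1 b2 : ℝ) {s y z : ℕ} (n : ℕ) (hy : s ≤ y) (hz : s ≤ z) :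
    racahTerm b0 b1 b2 s n y z
      = racahOne b0 (b1 + 2 * s) (b2 + 2 * s) (z - s : ℕ) n (y - s : ℕ) := by
  unfold racahTerm racahOne
  rw [Nat.cast_sub hy, Nat.cast_sub hz]
  congr 1 <;> ring

/-- In the k-th term, (-(y-s))_k vanishes if k > z - s, and the cleared factor (-(z-s)+k)_{n-k}
vanishes otherwise. -/
theorem racahTerm_eq_zero (b0 b1 b2 : ℝ) {s n y z : ℕ} (hsy : s ≤ y) (hyz : y ≤ z)
    (hz : z < s + n) : racahTerm b0 b1 b2 s n y z = 0 := by
  rw [racahTerm_eq b0 b1 b2 n hsy (hsy.trans hyz)]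
  unfold racahOne clearedHyp43
  refine Finset.sum_eq_zero fun k hk => ?_
  have hk : k ≤ n := Nat.lt_succ_iff.mp (Finset.mem_range.mp hk)
  rcases Nat.lt_or_ge (z - s) k with h | h
  · rw [poch_neg_of_lt (m := y - s) (by omega)]
    ring
  · rw [show -((z - s : ℕ) : ℝ) + k = -((z - s - k : ℕ) : ℝ) by rw [Nat.cast_sub h]; ring,
      poch_neg_of_lt (m := z - s - k) (k := n - k) (by omega)]
    ring

theorem poch_half_ne_zero {b : ℝ} {n : ℕ} (h : poch b (2 * n) ≠ 0) : poch (b / 2) n ≠ 0 := by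
  rw [poch_eq_prod]
  refine Finset.prod_ne_zero_iff.mpr fun i hi => ?_
  have := poch_factor_ne_zero (k := 2 * i) h (by have := Finset.mem_range.mp hi; omega)
  push_cast at this
  intro h0
  apply this
  linarith

theorem siteWeight_eq {b : ℝ} {y : ℕ} (hb : b ≠ 0) (h : poch (b / 2) y ≠ 0) :
    siteWeight b y = (b + 2 * y) / b := by
  have h1 := poch_succ_left (b / 2) y
  rw [poch_succ, show b / 2 + 1 = (b + 2) / 2 by ring] at h1
  rw [siteWeight, div_eq_div_iff h hb]
  linarith

/-- The shape, as a function of the free endpoint, of partial weighted norms. -/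
noncomputable def partialNorm (b0 b : ℝ) (s z : ℕ) : ℝ :=
  poch b (z + s) * poch (b + 2 * s - b0) (z - s) / ((z - s).factorial * poch (b0 + 1) (z - s))

/-- The factor contributed to the squared norm by one summation. -/
noncomputable def normFactor (b0 b1 b2 : ℝ) (s n : ℕ) : ℝ :=
  n.factorial * poch (b2 - b1) n * poch (b1 + 2 * s - b0) n * poch (n + b2 + 2 * s - b0 - 1) n

/-- The one-variable norm with b1 + 2s, b2 + 2s and z - s in place of b1, b2 and N. The result has
the shape of `partialNorm` again, now with s + n, which is what lets the summation be iterated. -/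
theorem sum_partialNorm {b0 : ℝ} (hb0 : -1 < b0) (b1 b2 : ℝ) {s n z : ℕ} (hz : s + n ≤ z)
    (h1 : poch b1 (2 * z + 1) ≠ 0) :
    ∑ y ∈ Finset.range (z + 1), (if s ≤ y then partialNorm b0 b1 s y else 0)
        * (siteWeight b1 y * stepWeight b1 b2 y z * racahTerm b0 b1 b2 s n y z ^ 2)
      = normFactor b0 b1 b2 s n * partialNorm b0 b2 (s + n) z := by
  obtain ⟨M, rfl⟩ : ∃ M, z = s + M := ⟨z - s, by omega⟩
  have hn : n ≤ M := by omega
  have hb1 : b1 ≠ 0 := by simpa using poch_factor_ne_zero (k := 0) h1 (by omega)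
  have hs1 : b1 + 2 * s ≠ 0 := by
    have := poch_factor_ne_zero (k := 2 * s) h1 (by omega)
    push_cast at this
    exact this
  have h1s : poch (b1 + 2 * s) (2 * M + 1) ≠ 0 := by
    have := poch_shift_ne_zero (k := 2 * s) (m := 2 * M + 1) h1 (by omega)
    push_cast at this
    exact this
  rw [show s + M + 1 = s + (M + 1) by ring, Finset.sum_range_add, Finset.sum_eq_zero, zero_add]
  swap
  · intro y hy
    rw [if_neg (by have := Finset.mem_range.mp hy; omega), zero_mul]
  have key : ∀ x ∈ Finset.range (M + 1),
      (if s ≤ s + x then partialNorm b0 b1 s (s + x) else 0)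
        * (siteWeight b1 (s + x) * stepWeight b1 b2 (s + x) (s + M)
          * racahTerm b0 b1 b2 s n (s + x) (s + M) ^ 2)
      = poch b2 (2 * s) * (poch (b1 + 2 * s - b0) x * poch (b1 + 2 * s) x
            / (x.factorial * poch (b0 + 1) x)
        * ((b1 + 2 * s + 2 * x) / (b1 + 2 * s))
        * (poch (b2 + 2 * s - (b1 + 2 * s)) (M - x) * poch (b2 + 2 * s) (M + x)
          / ((M - x).factorial * poch (b1 + 2 * s + 1) (M + x)))
        * racahOne b0 (b1 + 2 * s) (b2 + 2 * s) M n x ^ 2) := by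
    intro x hx
    have hx : x ≤ M := Nat.lt_succ_iff.mp (Finset.mem_range.mp hx)
    have n1 : poch (b1 / 2) (s + x) ≠ 0 := poch_half_ne_zero (poch_ne_zero_of_le h1 (by omega))
    rw [if_pos (Nat.le_add_right s x), siteWeight_eq hb1 n1,
      racahTerm_eq b0 b1 b2 n (Nat.le_add_right s x) (Nat.le_add_right s M)]
    unfold partialNorm stepWeight
    rw [Nat.add_sub_cancel_left, Nat.add_sub_cancel_left, show s + M - (s + x) = M - x by omega,
      show s + x + s = 2 * s + x by ring, show s + M + (s + x) = 2 * s + (M + x) by ring,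
      poch_add b1, poch_add b2, poch_add (b1 + 1)]
    -- The shift by 2s leaves (b1)_{2s} over b1 (b1+1)_{2s}; this quotient is 1/(b1 + 2s), the
    -- denominator of the shifted site factor.
    have e1 : b1 * poch (b1 + 1) (2 * s) = poch b1 (2 * s) * (b1 + 2 * s) := by
      have := poch_succ b1 (2 * s)
      rw [poch_succ_left] at this
      push_cast at this
      exact this
    have n2 : poch (b1 + 1) (2 * s) ≠ 0 := by
      have := poch_ne_zero_of_le h1 (m := 2 * s + 1) (by omega)
      rw [poch_succ_left] at this
      exact right_ne_zero_of_mul this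
    rw [show b1 + 1 + ((2 * s : ℕ) : ℝ) = b1 + 2 * s + 1 by push_cast; ring,
      show b2 + 2 * (s : ℝ) - (b1 + 2 * s) = b2 - b1 by ring]
    push_cast
    have hq : poch b1 (2 * s) = b1 * poch (b1 + 1) (2 * s) / (b1 + 2 * s) := by
      field_simp
      exact e1.symm
    rw [hq, show b1 + 2 * ((s : ℝ) + x) = b1 + 2 * s + 2 * x by ring]
    simp only [div_eq_mul_inv, mul_inv]
    have c1 := mul_inv_cancel₀ hb1
    have c2 := mul_inv_cancel₀ n2
    have alg : ∀ X Y b c p q : ℝ, b * c = 1 → p * q = 1 → X = Y → b * c * (p * q) * X = Y := by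
      intro X Y b c p q h1 h2 h3
      rw [h1, h2, h3]; ring
    refine Eq.trans ?_ (alg _ _ _ _ _ _ c1 c2 rfl)
    ring
  rw [Finset.sum_congr rfl key, ← Finset.mul_sum, racahOne_norm hb0 _ _ hn h1s]
  unfold normFactor partialNorm
  rw [show s + M + (s + n) = 2 * s + (M + n) by ring, poch_add b2,
    show s + M - (s + n) = M - n by omega,
    show b2 + 2 * (s : ℝ) - (b1 + 2 * s) = b2 - b1 by ring,
    show (n : ℝ) + (b2 + 2 * s) - b0 - 1 = n + b2 + 2 * s - b0 - 1 by ring,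
    show b2 + 2 * (s : ℝ) + 2 * n - b0 = b2 + 2 * (s + n : ℕ) - b0 by push_cast; ring]
  push_cast
  ring

theorem sum_partialNorm_eq_zero (b0 b1 b2 : ℝ) {s n z : ℕ} (hz : z < s + n) :
    ∑ y ∈ Finset.range (z + 1), (if s ≤ y then partialNorm b0 b1 s y else 0)
        * (siteWeight b1 y * stepWeight b1 b2 y z * racahTerm b0 b1 b2 s n y z ^ 2) = 0 := by
  refine Finset.sum_eq_zero fun y hy => ?_
  have hy : y ≤ z := Nat.lt_succ_iff.mp (Finset.mem_range.mp hy)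
  split_ifs with h
  · rw [racahTerm_eq_zero b0 b1 b2 h hy hz]
    ring
  · ring

/-- The transfer kernels whose iterated sum is the squared norm. -/
noncomputable def normKernel {d : ℕ} (ν : Fin d → ℕ) (β : ℕ → ℝ) : ℕ → ℕ → ℕ → ℝ
  | 0, y, z => stepWeight (β 0) (β 1) y z
  | j + 1, y, z => siteWeight (β (j + 1)) y * stepWeight (β (j + 1)) (β (j + 2)) y z
      * racahTerm (β 0) (β (j + 1)) (β (j + 2)) (partialSum ν j) (entry ν (j + 1)) y z ^ 2

theorem chain_normKernel {d N : ℕ} (ν : Fin d → ℕ) {β : ℕ → ℝ} (hb0 : -1 < β 0)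
    (h : ∀ i < d, poch (β (i + 1)) (2 * N + 1) ≠ 0) {j : ℕ} (hj : j ≤ d) {z : ℕ} (hz : z ≤ N) :
    chain (normKernel ν β) j z
      = (∏ i ∈ Finset.range j, normFactor (β 0) (β (i + 1)) (β (i + 2)) (partialSum ν i)
          (entry ν (i + 1)))
        * if partialSum ν j ≤ z then partialNorm (β 0) (β (j + 1)) (partialSum ν j) z else 0 := by
  induction j generalizing z with
  | zero =>
    simp [chain, normKernel, stepWeight, partialNorm]
    ring
  | succ j ih =>
    rw [chain]
    have e : ∀ y ∈ Finset.range (z + 1), chain (normKernel ν β) j y * normKernel ν β (j + 1) y z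
        = (∏ i ∈ Finset.range j, normFactor (β 0) (β (i + 1)) (β (i + 2)) (partialSum ν i)
            (entry ν (i + 1)))
          * ((if partialSum ν j ≤ y then partialNorm (β 0) (β (j + 1)) (partialSum ν j) y else 0)
            * normKernel ν β (j + 1) y z) := by
      intro y hy
      rw [ih (by omega) (by have := Finset.mem_range.mp hy; omega)]
      ring
    rw [Finset.sum_congr rfl e, ← Finset.mul_sum, Finset.prod_range_succ, partialSum_succ]
    simp only [normKernel]
    split_ifs with hz'
    · rw [sum_partialNorm hb0 _ _ hz' (poch_ne_zero_of_le (h j (by omega)) (by omega))]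
      ring
    · rw [sum_partialNorm_eq_zero _ _ _ (by omega)]
      ring

/-- The squared norm of the multivariable Racah polynomials. -/
theorem sum_weight_racah_sq {d N : ℕ} (ν : Fin d → ℕ) {β : ℕ → ℝ} (hb0 : -1 < β 0)
    (h : ∀ i < d, poch (β (i + 1)) (2 * N + 1) ≠ 0) (hν : partialSum ν d ≤ N) :
    ∑ y ∈ simplex d N, weight y β N * racah ν y β N ^ 2
      = (∏ i ∈ Finset.range d, normFactor (β 0) (β (i + 1)) (β (i + 2)) (partialSum ν i)
          (entry ν (i + 1)))
        * partialNorm (β 0) (β (d + 1)) (partialSum ν d) N := by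
  have := chain_normKernel ν hb0 h le_rfl (le_refl N)
  rw [if_pos hν, ← sum_simplex_prod] at this
  rw [← this]
  refine Finset.sum_congr rfl fun y _ => ?_
  rw [Finset.prod_range_succ', weight_eq, racah_eq, ← Finset.prod_pow, mul_assoc,
    ← Finset.prod_mul_distrib, mul_comm, node_zero]
  simp only [normKernel]

/-! ### Dual data and duality in several variables. -/

theorem racahTerm_dual {b0 : ℝ} (hb0 : -1 < b0) (b1 b2 : ℝ) {s n y z N : ℕ} (hsy : s ≤ y)
    (hyz : y ≤ z) (hn : s + n ≤ z) (hz : z ≤ N) :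
    poch (b2 - b1) (z - y) / ((y - s).factorial * poch (b0 + 1) (y - s))
        * racahTerm b0 b1 b2 s n y z
      = poch (b2 - b1) n / ((z - (s + n)).factorial * poch (b0 + 1) (z - (s + n)))
        * racahTerm b0 (b0 - b2 - 2 * N + 1) (b0 - b1 - 2 * N + 1) (N - z) (z - y)
          (N - (s + n)) (N - s) := by
  have h := racahOne_dual_nat hb0 (b1 + 2 * s) (b2 + 2 * s) (N := z - s) (n := n) (x := y - s)
    (by omega) (by omega)
  rw [racahTerm_eq b0 b1 b2 n hsy (hsy.trans hyz),
    racahTerm_eq b0 _ _ (z - y) (by omega) (by omega)]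
  rw [show z - s - (y - s) = z - y by omega, show z - s - n = z - (s + n) by omega,
    show b2 + 2 * (s : ℝ) - (b1 + 2 * s) = b2 - b1 by ring] at h
  rw [h, show N - s - (N - z) = z - s by omega, show N - (s + n) - (N - z) = z - (s + n) by omega]
  have e : ∀ b : ℝ, b0 - (b + 2 * s) - 2 * ((z - s : ℕ) : ℝ) + 1
      = b0 - b - 2 * N + 1 + 2 * ((N - z : ℕ) : ℝ) := by
    intro b
    rw [Nat.cast_sub hz, Nat.cast_sub (hsy.trans hyz)]
    ring
  rw [e, e]

theorem node_dualVar {d : ℕ} (ν : Fin d → ℕ) (N : ℕ) {i : ℕ} (hi : i ≤ d) :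
    node N (dualVar ν N) (i + 1) = N - partialSum ν (d - i) := by
  rcases Nat.lt_or_ge i d with h | h
  · rw [node_succ_of_lt N _ h]; rfl
  · obtain rfl : i = d := by omega
    simp [node_last]

theorem entry_dualIndex {d : ℕ} (x : Fin d → ℕ) (N : ℕ) {i : ℕ} (hi : i < d) :
    entry (dualIndex x N) (i + 1) = node N x (d + 1 - i) - node N x (d - i) := by
  rw [entry_succ _ hi]; rfl

theorem partialSum_dualIndex {d N : ℕ} {x : Fin d → ℕ} (hx : x ∈ simplex d N) {i : ℕ}
    (hi : i ≤ d) : partialSum (dualIndex x N) i = N - node N x (d + 1 - i) := by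
  induction i with
  | zero => simp [node_last]
  | succ i ih =>
    rw [partialSum_succ, ih (by omega), entry_dualIndex x N hi,
      show d + 1 - (i + 1) = d - i by omega]
    have h1 := node_le_succ hx (Nat.sub_le d i)
    rw [show d - i + 1 = d + 1 - i by omega] at h1
    have h2 := node_le hx (d + 1 - i)
    omega

@[simp] theorem dualParam_zero (d : ℕ) (β : ℕ → ℝ) (N : ℕ) : dualParam d β N 0 = β 0 := by
  simp [dualParam]

theorem dualParam_succ (d : ℕ) (β : ℕ → ℝ) (N j : ℕ) :
    dualParam d β N (j + 1) = β 0 - β (d + 1 - j) - 2 * N + 1 := by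
  rw [dualParam, if_neg (Nat.succ_ne_zero j), show d + 2 - (j + 1) = d + 1 - j by omega]

theorem dualVar_mem {d : ℕ} (ν : Fin d → ℕ) (N : ℕ) : dualVar ν N ∈ simplex d N := by
  rw [mem_simplex]
  refine ⟨fun i => Nat.sub_le _ _, fun i j hij => ?_⟩
  have : (i : ℕ) ≤ j := hij
  exact Nat.sub_le_sub_left (partialSum_mono ν (by omega)) N

theorem dualVar_dualIndex {d N : ℕ} {x : Fin d → ℕ} (hx : x ∈ simplex d N) :
    dualVar (dualIndex x N) N = x := by
  funext i
  have h2 := node_le hx (i + 1)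
  rw [dualVar, partialSum_dualIndex hx (Nat.sub_le _ _),
    show d + 1 - (d - (i : ℕ)) = i + 1 by omega, Nat.sub_sub_self h2, node_succ_of_lt N x i.2]

theorem dualParam_dualParam {d : ℕ} (β : ℕ → ℝ) (N : ℕ) {j : ℕ} (hj : j ≤ d + 1) :
    dualParam d (dualParam d β N) N j = β j := by
  rcases j with _ | j
  · simp
  · rw [dualParam_succ, dualParam_zero, show d + 1 - j = (d - j) + 1 by omega, dualParam_succ,
      show d + 1 - (d - j) = j + 1 by omega]
    ring

theorem weight_congr {d : ℕ} (x : Fin d → ℕ) {β γ : ℕ → ℝ} (N : ℕ)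
    (h : ∀ j ≤ d + 1, β j = γ j) : weight x β N = weight x γ N := by
  rw [weight_eq, weight_eq, h 0 (by omega), h 1 (by omega)]
  congr 1
  refine Finset.prod_congr rfl fun i hi => ?_
  have := Finset.mem_range.mp hi
  rw [h (i + 1) (by omega), h (i + 2) (by omega)]

theorem weight_dual_dual {d N : ℕ} {x : Fin d → ℕ} (hx : x ∈ simplex d N) (β : ℕ → ℝ) :
    weight (dualVar (dualIndex x N) N) (dualParam d (dualParam d β N) N) N = weight x β N := by
  rw [dualVar_dualIndex hx]
  exact weight_congr x N fun j hj => dualParam_dualParam β N hj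

/-- The value of the dual weight at a dual point. -/
theorem weight_dual {d : ℕ} (ν : Fin d → ℕ) (β : ℕ → ℝ) (N : ℕ) :
    weight (dualVar ν N) (dualParam d β N) N
      = stepWeight (β 0) (β 0 - β (d + 1) - 2 * N + 1) 0 (N - partialSum ν d)
        * ∏ i ∈ Finset.range d,
          (siteWeight (β 0 - β (i + 2) - 2 * N + 1) (N - partialSum ν (i + 1))
            * stepWeight (β 0 - β (i + 2) - 2 * N + 1) (β 0 - β (i + 1) - 2 * N + 1)
              (N - partialSum ν (i + 1)) (N - partialSum ν i)) := by
  -- Duality reverses the order of the coordinates, so the product is read from the other end.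
  rw [weight_eq, ← Finset.prod_range_reflect, dualParam_zero, node_dualVar ν N (Nat.zero_le d),
    dualParam_succ]
  congr 1
  refine Finset.prod_congr rfl fun i hi => ?_
  have hi := Finset.mem_range.mp hi
  rw [dualParam_succ, dualParam_succ, node_dualVar ν N (by omega), node_dualVar ν N (by omega),
    show d + 1 - (d - 1 - i) = i + 2 by omega, show d + 1 - (d - 1 - i + 1) = i + 1 by omega,
    show d - (d - 1 - i) = i + 1 by omega, show d - (d - 1 - i + 1) = i by omega]

theorem racah_dual {d N : ℕ} (ν : Fin d → ℕ) {x : Fin d → ℕ} (hx : x ∈ simplex d N)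
    (β : ℕ → ℝ) :
    racah (dualIndex x N) (dualVar ν N) (dualParam d β N) N
      = ∏ i ∈ Finset.range d, racahTerm (β 0) (β 0 - β (i + 2) - 2 * N + 1)
          (β 0 - β (i + 1) - 2 * N + 1) (N - node N x (i + 2))
          (node N x (i + 2) - node N x (i + 1)) (N - partialSum ν (i + 1))
          (N - partialSum ν i) := by
  rw [racah_eq, ← Finset.prod_range_reflect]
  refine Finset.prod_congr rfl fun i hi => ?_
  have hi := Finset.mem_range.mp hi
  rw [dualParam_succ, dualParam_succ, dualParam_zero, node_dualVar ν N (by omega),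
    node_dualVar ν N (by omega), partialSum_dualIndex hx (by omega),
    entry_dualIndex x N (by omega),
    show d + 1 - (d - 1 - i) = i + 2 by omega, show d + 1 - (d - 1 - i + 1) = i + 1 by omega,
    show d - (d - 1 - i) = i + 1 by omega, show d - (d - 1 - i + 1) = i by omega]

/-- The factor relating Racah polynomials to their duals. -/
noncomputable def dualCoeff {d : ℕ} (ν : Fin d → ℕ) (β : ℕ → ℝ) (N : ℕ) : ℝ :=
  (∏ i ∈ Finset.range d, poch (β (i + 2) - β (i + 1)) (entry ν (i + 1)))
    / ((N - partialSum ν d).factorial * poch (β 0 + 1) (N - partialSum ν d))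

theorem dualCoeff_dual {d N : ℕ} {x : Fin d → ℕ} (hx : x ∈ simplex d N) (β : ℕ → ℝ) :
    dualCoeff (dualIndex x N) (dualParam d β N) N
      = (∏ i ∈ Finset.range d,
          poch (β (i + 2) - β (i + 1)) (node N x (i + 2) - node N x (i + 1)))
        / ((node N x 1).factorial * poch (β 0 + 1) (node N x 1)) := by
  rw [dualCoeff, partialSum_dualIndex hx le_rfl, dualParam_zero,
    show d + 1 - d = 1 by omega, Nat.sub_sub_self (node_le hx 1), ← Finset.prod_range_reflect]
  congr 1
  refine Finset.prod_congr rfl fun i hi => ?_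
  have hi := Finset.mem_range.mp hi
  rw [dualParam_succ, dualParam_succ, entry_dualIndex x N (by omega),
    show d + 1 - (d - 1 - i) = i + 2 by omega, show d + 1 - (d - 1 - i + 1) = i + 1 by omega,
    show d - (d - 1 - i) = i + 1 by omega]
  congr 1
  ring

theorem dualCoeff_pos {d : ℕ} (ν : Fin d → ℕ) {β : ℕ → ℝ} (N : ℕ) (hb0 : -1 < β 0)
    (hβ : ∀ i < d, β (i + 1) < β (i + 2)) : 0 < dualCoeff ν β N := by
  refine div_pos (Finset.prod_pos fun i hi => poch_pos ?_ _)
    (mul_pos (by positivity) (poch_pos (by linarith) _))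
  exact sub_pos.mpr (hβ i (Finset.mem_range.mp hi))

theorem prod_telescope (f g q : ℕ → ℝ) (d : ℕ) (h : ∀ i < d, f i * q (i + 1) = g i * q i) :
    (∏ i ∈ Finset.range d, f i) * q d = (∏ i ∈ Finset.range d, g i) * q 0 := by
  induction d with
  | zero => simp
  | succ d ih =>
    rw [Finset.prod_range_succ, Finset.prod_range_succ]
    have h1 := h d (by omega)
    have h2 := ih fun i hi => h i (by omega)
    linear_combination (∏ i ∈ Finset.range d, f i) * h1 + g d * h2

theorem racah_eq_zero {d N : ℕ} (ν : Fin d → ℕ) {x : Fin d → ℕ} (hx : x ∈ simplex d N)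
    (β : ℕ → ℝ) (h : ∃ j ≤ d, node N x (j + 1) < partialSum ν j) : racah ν x β N = 0 := by
  classical
  obtain ⟨h1, h2⟩ := Nat.find_spec h
  -- At the least violation j + 1, s_j ≤ x_{j+1} ≤ x_{j+2} < s_{j+1}, which is the vanishing range
  -- of the factor with index j.
  have hmin : ∀ m < Nat.find h, ¬ (m ≤ d ∧ node N x (m + 1) < partialSum ν m) :=
    fun m hm => Nat.find_min h hm
  generalize Nat.find h = j at h1 h2 hmin
  rcases j with _ | j
  · simp at h2
  · have h3 := hmin j (by omega)
    rw [racah_eq]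
    refine Finset.prod_eq_zero (i := j) (Finset.mem_range.mpr (by omega))
      (racahTerm_eq_zero _ _ _ (by by_contra; exact h3 ⟨by omega, by omega⟩)
        (node_le_succ hx h1) ?_)
    rw [← partialSum_succ]
    exact h2

/-- Duality of the multivariable Racah polynomials. -/
theorem dualCoeff_mul_racah {d N : ℕ} {ν x : Fin d → ℕ} (hx : x ∈ simplex d N)
    (hν : partialSum ν d ≤ N) {β : ℕ → ℝ} (hb0 : -1 < β 0) :
    dualCoeff (dualIndex x N) (dualParam d β N) N * racah ν x β N
      = dualCoeff ν β N * racah (dualIndex x N) (dualVar ν N) (dualParam d β N) N := by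
  -- The condition is self-dual under j ↦ d - j, so in this case both polynomials vanish; otherwise
  -- the one-variable dualities apply to every factor.
  by_cases h : ∃ j ≤ d, node N x (j + 1) < partialSum ν j
  · rw [racah_eq_zero ν hx β h, racah_eq_zero _ (dualVar_mem ν N), mul_zero, mul_zero]
    obtain ⟨j, hj, hlt⟩ := h
    refine ⟨d - j, Nat.sub_le _ _, ?_⟩
    rw [node_dualVar ν N (Nat.sub_le _ _), partialSum_dualIndex hx (Nat.sub_le _ _),
      show d - (d - j) = j by omega, show d + 1 - (d - j) = j + 1 by omega]
    have h1 : partialSum ν j ≤ N := (partialSum_mono ν hj).trans hν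
    omega
  · push Not at h
    rw [dualCoeff_dual hx, racah_dual ν hx, racah_eq, dualCoeff]
    have hg : ∀ k, (k.factorial : ℝ) * poch (β 0 + 1) k ≠ 0 := fun k =>
      mul_ne_zero (by positivity) (poch_pos (by linarith) _).ne'
    have := prod_telescope
      (fun i => poch (β (i + 2) - β (i + 1)) (node N x (i + 2) - node N x (i + 1))
        * racahTerm (β 0) (β (i + 1)) (β (i + 2)) (partialSum ν i) (entry ν (i + 1))
          (node N x (i + 1)) (node N x (i + 2)))
      (fun i => poch (β (i + 2) - β (i + 1)) (entry ν (i + 1))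
        * racahTerm (β 0) (β 0 - β (i + 2) - 2 * N + 1)
          (β 0 - β (i + 1) - 2 * N + 1) (N - node N x (i + 2))
          (node N x (i + 2) - node N x (i + 1)) (N - partialSum ν (i + 1))
          (N - partialSum ν i))
      (fun i => ((node N x (i + 1) - partialSum ν i).factorial : ℝ)
        * poch (β 0 + 1) (node N x (i + 1) - partialSum ν i)) d (by
      intro i hi
      have h1 := racahTerm_dual hb0 (β (i + 1)) (β (i + 2)) (h i hi.le)
        (node_le_succ hx (j := i + 1) hi) (n := entry ν (i + 1))
        (by rw [← partialSum_succ]; exact h (i + 1) hi) (node_le hx (i + 2))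
      rw [← partialSum_succ, div_mul_eq_mul_div, div_mul_eq_mul_div,
        div_eq_div_iff (hg _) (hg _)] at h1
      exact h1)
    rw [Finset.prod_mul_distrib, Finset.prod_mul_distrib, node_last, partialSum_zero,
      Nat.sub_zero] at this
    rw [div_mul_eq_mul_div, div_mul_eq_mul_div, div_eq_div_iff (hg _) (hg _)]
    exact this

/-! ### The norm against the dual weight. -/

/-- One summation's norm factor times the matching dual weight factor is (b2-b1)_n² times a ratio of
consecutive values of (β_{i+1}-β_0+2s_i)_{2(N-s_i)}. These ratios telescope to (β_1-β_0)_{2N}, and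
the value at i = d is absorbed by `partialNorm_mul_dual`. -/
theorem normFactor_mul_dual (b0 b1 b2 : ℝ) {s n N : ℕ} (h : s + n ≤ N)
    (h0 : poch (b2 - b0 - 1) (2 * N + 1) ≠ 0) :
    normFactor b0 b1 b2 s n * (siteWeight (b0 - b2 - 2 * N + 1) (N - (s + n))
        * stepWeight (b0 - b2 - 2 * N + 1) (b0 - b1 - 2 * N + 1) (N - (s + n)) (N - s))
        * poch (b2 - b0 + 2 * (s + n : ℕ)) (2 * (N - (s + n)))
      = poch (b2 - b1) n ^ 2 * poch (b1 - b0 + 2 * s) (2 * (N - s)) := by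
  obtain ⟨p, rfl⟩ : ∃ p, N = s + n + p := ⟨N - (s + n), by omega⟩
  have n1 : b2 - b0 - 1 + 2 * (s + n + p : ℕ) ≠ 0 := by
    have := poch_factor_ne_zero (k := 2 * (s + n + p)) h0 (by omega)
    push_cast at this ⊢
    exact this
  have n2 : poch (b2 - b0 - 1 + 2 * s + n) (n + 2 * p) ≠ 0 := by
    have := poch_shift_ne_zero (k := 2 * s + n) (m := n + 2 * p) h0 (by omega)
    push_cast at this
    rwa [← add_assoc] at this
  have n3 : poch ((b0 - b2 - 2 * (s + n + p : ℕ) + 1) / 2) p ≠ 0 := by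
    apply poch_half_ne_zero
    rw [poch_reflect' (a := b2 - b0 - 1 + (2 * (s + n) + 1 : ℕ)) (by push_cast; ring)]
    exact mul_ne_zero (pow_ne_zero _ (by norm_num)) (poch_shift_ne_zero h0 (by omega))
  rw [show s + n + p - (s + n) = p by omega, show s + n + p - s = n + p by omega,
    siteWeight_eq (by intro h; apply n1; linarith) n3]
  unfold normFactor stepWeight
  rw [show n + p - p = n by omega, show n + p + p = n + 2 * p by ring,
    poch_reflect' (a := b1 - b0 + 2 * s + n) (b := b0 - b1 - 2 * (s + n + p : ℕ) + 1)
      (by push_cast; ring),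
    poch_reflect' (a := b2 - b0 - 1 + 2 * s + n) (b := b0 - b2 - 2 * (s + n + p : ℕ) + 1 + 1)
      (by push_cast; ring),
    show 2 * (n + p) = n + (n + 2 * p) by ring, poch_add (b1 - b0 + 2 * s) n]
  -- One rising factorial of length n + 2p + 1, split once before its last factor and once after its
  -- first n factors.
  have e1 : poch (b2 - b0 - 1 + 2 * s + n) (n + 2 * p) * (b2 - b0 - 1 + 2 * (s + n + p : ℕ))
      = poch (n + b2 + 2 * s - b0 - 1) n
        * ((b2 - b0 - 1 + 2 * (s + n : ℕ)) * poch (b2 - b0 + 2 * (s + n : ℕ)) (2 * p)) := by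
    have h1 := poch_succ_left (b2 - b0 - 1 + 2 * (s + n : ℕ)) (2 * p)
    rw [poch_succ, show b2 - b0 - 1 + 2 * ((s + n : ℕ) : ℝ) + 1 = b2 - b0 + 2 * (s + n : ℕ) by
      ring] at h1
    rw [← h1, poch_add, show (n : ℝ) + b2 + 2 * s - b0 - 1 = b2 - b0 - 1 + 2 * s + n by ring,
      show b2 - b0 - 1 + 2 * (s : ℝ) + n + n = b2 - b0 - 1 + 2 * (s + n : ℕ) by push_cast; ring]
    push_cast
    ring
  have s1 := neg_one_pow_mul_self (n + 2 * p)
  have s2 : ((-1 : ℝ) ^ (n + 2 * p)) ≠ 0 := pow_ne_zero _ (by norm_num)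
  have n4 : (n.factorial : ℝ) ≠ 0 := by positivity
  have n5 : b0 - b2 - 2 * (s + n + p : ℕ) + 1 ≠ 0 := by intro h; apply n1; linarith
  rw [show b0 - b1 - 2 * ((s + n + p : ℕ) : ℝ) + 1 - (b0 - b2 - 2 * (s + n + p : ℕ) + 1)
      = b2 - b1 by ring,
    show b0 - b2 - 2 * ((s + n + p : ℕ) : ℝ) + 1 + 2 * p
      = -(b2 - b0 - 1 + 2 * (s + n : ℕ)) by push_cast; ring,
    show b0 - b2 - 2 * ((s + n + p : ℕ) : ℝ) + 1
      = -(b2 - b0 - 1 + 2 * (s + n + p : ℕ)) by ring,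
    show b1 + 2 * (s : ℝ) - b0 = b1 - b0 + 2 * s by ring, neg_div_neg_eq]
  generalize poch (b2 - b0 - 1 + 2 * s + n) (n + 2 * p) = q1 at *
  generalize poch (b2 - b0 + 2 * (s + n : ℕ)) (2 * p) = q2 at *
  generalize poch (n + b2 + 2 * s - b0 - 1) n = q3 at *
  generalize poch (b1 - b0 + 2 * s) n = q4 at *
  generalize poch (b1 - b0 + 2 * s + n) (n + 2 * p) = q5 at *
  generalize poch (b2 - b1) n = q6 at *
  generalize b2 - b0 - 1 + 2 * ((s + n + p : ℕ) : ℝ) = q7 at *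
  generalize b2 - b0 - 1 + 2 * ((s + n : ℕ) : ℝ) = q8 at *
  generalize (-1 : ℝ) ^ (n + 2 * p) = t at *
  generalize (n.factorial : ℝ) = f at *
  have e2 : f * q6 * q4 * q3 * (q8 / q7 * (q6 * (t * q5) / (f * (t * q1)))) * q2
      = q6 ^ 2 * (q4 * q5) * ((q3 * (q8 * q2)) / (q1 * q7)) := by
    field_simp
  rw [e2, ← e1, div_self (mul_ne_zero n2 n1), mul_one]

theorem partialNorm_mul_dual (b0 b : ℝ) {s N : ℕ} (h : s ≤ N) :
    partialNorm b0 b s N * stepWeight b0 (b0 - b - 2 * N + 1) 0 (N - s)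
      = poch b (2 * N) * poch (b - b0 + 2 * s) (2 * (N - s))
        / ((N - s).factorial * poch (b0 + 1) (N - s)) ^ 2 := by
  obtain ⟨p, rfl⟩ : ∃ p, N = s + p := ⟨N - s, by omega⟩
  unfold partialNorm stepWeight
  rw [Nat.add_sub_cancel_left, Nat.sub_zero, Nat.add_zero,
    poch_reflect' (a := b + (2 * s + p : ℕ)) (b := b0 - b - 2 * (s + p : ℕ) + 1 - b0)
      (by push_cast; ring),
    poch_reflect' (a := b - b0 + 2 * s + p) (b := b0 - b - 2 * (s + p : ℕ) + 1)
      (by push_cast; ring),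
    show 2 * (s + p) = 2 * s + p + p by ring, poch_add b (2 * s + p) p,
    show 2 * p = p + p by ring, poch_add (b - b0 + 2 * s) p p,
    show s + p + s = 2 * s + p by ring, show b + 2 * (s : ℝ) - b0 = b - b0 + 2 * s by ring]
  have s1 := neg_one_pow_mul_self p
  rw [div_mul_div_comm, sq]
  congr 1
  linear_combination (poch b (2 * s + p) * poch (b - b0 + 2 * s) p
    * poch (b + (2 * s + p : ℕ)) p * poch (b - b0 + 2 * s + p) p) * s1

/-- The squared norm in terms of the dual weight. -/
theorem normSq_mul_weight_dual {d N : ℕ} (ν : Fin d → ℕ) {β : ℕ → ℝ} (hb0 : -1 < β 0)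
    (h1 : ∀ i < d, poch (β (i + 1)) (2 * N + 1) ≠ 0)
    (h2 : ∀ i < d, poch (β (i + 2) - β 0 - 1) (2 * N + 1) ≠ 0) (hν : partialSum ν d ≤ N) :
    (∑ y ∈ simplex d N, weight y β N * racah ν y β N ^ 2)
        * weight (dualVar ν N) (dualParam d β N) N
      = poch (β (d + 1)) (2 * N) * poch (β 1 - β 0) (2 * N) * dualCoeff ν β N ^ 2 := by
  have ht := prod_telescope
    (fun i => normFactor (β 0) (β (i + 1)) (β (i + 2)) (partialSum ν i) (entry ν (i + 1))
      * (siteWeight (β 0 - β (i + 2) - 2 * N + 1) (N - partialSum ν (i + 1))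
        * stepWeight (β 0 - β (i + 2) - 2 * N + 1) (β 0 - β (i + 1) - 2 * N + 1)
          (N - partialSum ν (i + 1)) (N - partialSum ν i)))
    (fun i => poch (β (i + 2) - β (i + 1)) (entry ν (i + 1)) ^ 2)
    (fun i => poch (β (i + 1) - β 0 + 2 * partialSum ν i) (2 * (N - partialSum ν i))) d (by
    intro i hi
    have h3 : partialSum ν (i + 1) ≤ N := (partialSum_mono ν hi).trans hν
    rw [partialSum_succ] at h3 ⊢
    exact normFactor_mul_dual _ _ _ h3 (h2 i hi))
  rw [Finset.prod_mul_distrib, Finset.prod_pow, partialSum_zero] at ht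
  rw [sum_weight_racah_sq ν hb0 h1 hν, weight_dual, dualCoeff, div_pow]
  have he := partialNorm_mul_dual (β 0) (β (d + 1)) hν
  simp only [Nat.cast_zero, mul_zero, add_zero, Nat.sub_zero, zero_add] at ht
  rw [show ∀ A B C D : ℝ, A * B * (C * D) = (A * D) * (B * C) by intros; ring, he,
    ← mul_div_assoc, ← mul_div_assoc]
  congr 1
  linear_combination poch (β (d + 1)) (2 * N) * ht

/-! ### Nonvanishing and the duality of orthonormal functions. -/

theorem const_mem_simplex (d N : ℕ) : (fun _ : Fin d => N) ∈ simplex d N := by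
  rw [mem_simplex]
  exact ⟨fun _ => le_rfl, fun _ _ _ => le_rfl⟩

theorem node_const (d N i : ℕ) : node N (fun _ : Fin d => N) (i + 1) = N := by
  simp [node]

/-- Well-definedness of the weight at the corner `(N, …, N)` excludes zeros of the parameters. -/
theorem poch_ne_zero_of_weight {d N : ℕ} (hN : 1 ≤ N) {β : ℕ → ℝ}
    (h : ∀ y ∈ simplex d N, 0 < weight y β N) {i : ℕ} (hi : i < d) :
    poch (β (i + 1)) (2 * N + 1) ≠ 0 ∧ poch (β (i + 2)) (2 * N) ≠ 0 := by
  -- Since division by zero gives 0, a nonzero weight has nonzero denominators as well as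
  -- numerators. At this corner the Pochhammer symbols needed have their maximal length 2N.
  have h1 := (h _ (const_mem_simplex d N)).ne'
  rw [weight_eq] at h1
  have h2 := Finset.prod_ne_zero_iff.mp (right_ne_zero_of_mul h1) i (Finset.mem_range.mpr hi)
  rw [node_const, node_const] at h2
  obtain ⟨h3, h4⟩ := mul_ne_zero_iff.mp h2
  simp only [siteWeight, stepWeight, ne_eq, div_eq_zero_iff, not_or, mul_eq_zero,
    ← two_mul] at h3 h4
  have h5 : β (i + 1) ≠ 0 := by
    have := poch_factor_ne_zero (k := 0) h3.2 (by omega)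
    intro h0
    simp [h0] at this
  refine ⟨?_, h4.1.2⟩
  rw [poch_succ_left]
  exact mul_ne_zero h5 h4.2.2

theorem node_zero_right {d : ℕ} {y : Fin d → ℕ} (hy : y ∈ simplex d 0) (j : ℕ) :
    node 0 y j = 0 := Nat.le_zero.mp (node_le hy j)

theorem weight_zero_right {d : ℕ} {y : Fin d → ℕ} (hy : y ∈ simplex d 0) (β : ℕ → ℝ) :
    weight y β 0 = 1 := by
  rw [weight_eq]
  simp [node_zero_right hy, stepWeight, siteWeight]

theorem racah_zero_right {d : ℕ} {ν y : Fin d → ℕ} (hν : partialSum ν d ≤ 0) (β : ℕ → ℝ) :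
    racah ν y β 0 = 1 := by
  rw [racah_eq]
  refine Finset.prod_eq_one fun i hi => ?_
  have h1 := (partialSum_mono ν (Finset.mem_range.mp hi)).trans hν
  change partialSum ν (i + 1) ≤ 0 at h1
  rw [partialSum_succ] at h1
  rw [show entry ν (i + 1) = 0 by omega]
  simp [racahTerm, clearedHyp43]

theorem racahNorm_zero_right {d : ℕ} {ν : Fin d → ℕ} (hν : partialSum ν d ≤ 0) (β : ℕ → ℝ) :
    racahNorm ν β 0 = Real.sqrt (simplex d 0).card := by
  rw [racahNorm]
  congr 1
  rw [Finset.sum_congr rfl fun y hy => by rw [weight_zero_right hy, racah_zero_right hν]]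
  simp

theorem racahNorm_sq {d N : ℕ} (ν : Fin d → ℕ) {β : ℕ → ℝ}
    (h : ∀ y ∈ simplex d N, 0 < weight y β N) :
    racahNorm ν β N ^ 2 = ∑ y ∈ simplex d N, weight y β N * racah ν y β N ^ 2 :=
  Real.sq_sqrt (Finset.sum_nonneg fun y hy => mul_nonneg (h y hy).le (sq_nonneg _))

theorem duality_of_pos {d N : ℕ} (hd : 1 ≤ d) {β : ℕ → ℝ} (hb0 : -1 < β 0)
    (hβ : ∀ j, 1 ≤ j → j ≤ d → β j < β (j + 1))
    (hw : ∀ y ∈ simplex d N, 0 < weight y β N)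
    (hw' : ∀ y ∈ simplex d N, 0 < weight y (dualParam d β N) N)
    {x : Fin d → ℕ} (hx : x ∈ simplex d N) {ν : Fin d → ℕ} (hν : partialSum ν d ≤ N) :
    0 < racahNorm ν β N ∧ 0 < racahNorm (dualIndex x N) (dualParam d β N) N ∧
      Real.sqrt (weight x β N) * orthoRacah ν x β N
        = Real.sqrt (weight (dualVar ν N) (dualParam d β N) N)
          * orthoRacah (dualIndex x N) (dualVar ν N) (dualParam d β N) N := by
  have hν' : partialSum (dualIndex x N) d ≤ N := by
    rw [partialSum_dualIndex hx le_rfl]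
    exact Nat.sub_le _ _
  -- For N = 0 the weight imposes nothing on β, but weights and polynomials are all 1.
  rcases Nat.eq_zero_or_pos N with rfl | hN
  · have hc : 0 < Real.sqrt ((simplex d 0).card : ℝ) :=
      Real.sqrt_pos.mpr (Nat.cast_pos.mpr (Finset.card_pos.mpr ⟨x, hx⟩))
    rw [orthoRacah, orthoRacah, racahNorm_zero_right hν, racahNorm_zero_right hν',
      racah_zero_right hν, racah_zero_right hν', weight_zero_right hx,
      weight_zero_right (dualVar_mem ν 0)]
    exact ⟨hc, hc, rfl⟩
  have h1 : ∀ i < d, poch (β (i + 1)) (2 * N + 1) ≠ 0 := fun i hi =>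
    (poch_ne_zero_of_weight hN hw hi).1
  have h2' : ∀ i < d, poch (dualParam d β N (i + 1)) (2 * N + 1) ≠ 0 := fun i hi =>
    (poch_ne_zero_of_weight hN hw' hi).1
  have hrefl : ∀ {a b : ℝ} {n : ℕ}, a + b + n = 1 → poch b n ≠ 0 → poch a n ≠ 0 := by
    intro a b n hab hb ha
    rw [poch_reflect' hab, ha, mul_zero] at hb
    exact hb rfl
  -- Reflection exchanges the two nonvanishing conditions for β and for the dual parameters.
  have h2 : ∀ i < d, poch (β (i + 2) - β 0 - 1) (2 * N + 1) ≠ 0 := by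
    intro i hi
    have h3 := h2' (d - 1 - i) (by omega)
    rw [dualParam_succ, show d + 1 - (d - 1 - i) = i + 2 by omega] at h3
    exact hrefl (by push_cast; ring) h3
  have h1' : ∀ i < d, poch (dualParam d β N (i + 2) - dualParam d β N 0 - 1) (2 * N + 1) ≠ 0 := by
    intro i hi
    rw [dualParam_succ, dualParam_zero]
    have h3 := h1 (d - 1 - i) (by omega)
    rw [show d - 1 - i + 1 = d + 1 - (i + 1) by omega] at h3
    exact hrefl (by push_cast; ring) h3
  have k1 : poch (β (d + 1)) (2 * N) ≠ 0 := by
    have h3 := (poch_ne_zero_of_weight hN hw (i := d - 1) (by omega)).2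
    rwa [show d - 1 + 2 = d + 1 by omega] at h3
  have k2 : poch (β 1 - β 0) (2 * N) ≠ 0 := by
    have h3 := (poch_ne_zero_of_weight hN hw' (i := d - 1) (by omega)).2
    rw [show d - 1 + 2 = d + 1 by omega, dualParam_succ, show d + 1 - d = 1 by omega] at h3
    exact hrefl (by push_cast; ring) h3
  have hb0' : -1 < dualParam d β N 0 := by rwa [dualParam_zero]
  have hβ1 : ∀ i < d, β (i + 1) < β (i + 2) := fun i hi => hβ (i + 1) (by omega) hi
  have hβ1' : ∀ i < d, dualParam d β N (i + 1) < dualParam d β N (i + 2) := by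
    intro i hi
    rw [dualParam_succ, dualParam_succ]
    have h3 := hβ (d + 1 - (i + 1)) (by omega) (by omega)
    rw [show d + 1 - (i + 1) + 1 = d + 1 - i by omega] at h3
    linarith
  have c1 := dualCoeff_pos ν N hb0 hβ1
  have c2 := dualCoeff_pos (dualIndex x N) N hb0' hβ1'
  have e1 := normSq_mul_weight_dual ν hb0 h1 h2 hν
  have e2 := normSq_mul_weight_dual (dualIndex x N) hb0' h2' h1' hν'
  rw [weight_dual_dual hx, dualParam_zero, dualParam_succ, dualParam_succ,
    show d + 1 - d = 1 by omega, show d + 1 - 0 = d + 1 by omega,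
    poch_reflect' (a := β 1 - β 0) (b := β 0 - β 1 - 2 * N + 1) (by push_cast; ring),
    poch_reflect' (a := β (d + 1)) (b := β 0 - β (d + 1) - 2 * N + 1 - β 0)
      (by push_cast; ring)] at e2
  have e3 := dualCoeff_mul_racah (ν := ν) hx hν hb0
  rw [← racahNorm_sq ν hw] at e1
  rw [← racahNorm_sq _ hw'] at e2
  have w1 := hw x hx
  have w2 := hw' _ (dualVar_mem ν N)
  have r1 : 0 ≤ racahNorm ν β N := Real.sqrt_nonneg _
  have r2 : 0 ≤ racahNorm (dualIndex x N) (dualParam d β N) N := Real.sqrt_nonneg _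
  have hs := neg_one_pow_mul_self (2 * N)
  rw [orthoRacah, orthoRacah]
  generalize racahNorm ν β N = r at *
  generalize racahNorm (dualIndex x N) (dualParam d β N) N = r' at *
  generalize weight x β N = w at *
  generalize weight (dualVar ν N) (dualParam d β N) N = w' at *
  generalize dualCoeff ν β N = c at *
  generalize dualCoeff (dualIndex x N) (dualParam d β N) N = c' at *
  generalize racah ν x β N = R at *
  generalize racah (dualIndex x N) (dualVar ν N) (dualParam d β N) N = R' at *
  -- `K` is self-dual: reflecting its two factors interchanges them, each with the sign (-1)^{2N}.
  set K := poch (β (d + 1)) (2 * N) * poch (β 1 - β 0) (2 * N) with hK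
  have hK0 : K ≠ 0 := mul_ne_zero k1 k2
  have e2 : r' ^ 2 * w = K * c' ^ 2 := by
    rw [e2, hK]
    linear_combination (poch (β 1 - β 0) (2 * N) * poch (β (d + 1)) (2 * N) * c' ^ 2) * hs
  have hr : 0 < r := by
    refine lt_of_le_of_ne r1 fun h0 => ?_
    rw [← h0] at e1
    have := mul_ne_zero hK0 (pow_ne_zero 2 c1.ne')
    apply this
    rw [← e1]
    ring
  have hr' : 0 < r' := by
    refine lt_of_le_of_ne r2 fun h0 => ?_
    rw [← h0] at e2
    have := mul_ne_zero hK0 (pow_ne_zero 2 c2.ne')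
    apply this
    rw [← e2]
    ring
  refine ⟨hr, hr', ?_⟩
  have q1 : Real.sqrt w' * r = Real.sqrt K * c := by
    rw [← Real.sqrt_sq r1, ← Real.sqrt_mul w2.le, mul_comm w', e1,
      Real.sqrt_mul' _ (sq_nonneg _), Real.sqrt_sq c1.le]
  have q2 : Real.sqrt w * r' = Real.sqrt K * c' := by
    rw [← Real.sqrt_sq r2, ← Real.sqrt_mul w1.le, mul_comm w, e2,
      Real.sqrt_mul' _ (sq_nonneg _), Real.sqrt_sq c2.le]
  rw [← mul_div_assoc, ← mul_div_assoc, div_eq_div_iff hr.ne' hr'.ne']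
  linear_combination R * q2 - R' * q1 + Real.sqrt K * e3

/-! ### Positivity of both weights. -/

/-- Positivity of the weight. -/
theorem weight_pos {d N : ℕ} {β : ℕ → ℝ} (hb0 : -1 < β 0) (h01 : β 0 < β 1)
    (hβ : ∀ j, 1 ≤ j → j ≤ d → β j < β (j + 1)) (hlast : 0 < β (d + 1))
    (hne : ∀ j, 1 ≤ j → j ≤ d → β j ≠ 0) {y : Fin d → ℕ} (hy : y ∈ simplex d N) :
    0 < weight y β N := by
  have hlt : ∀ j ≤ d, β j < β (j + 1) := by
    intro j hj
    rcases j with _ | j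
    · exact h01
    · exact hβ (j + 1) (by omega) hj
  have hgt : ∀ j ≤ d, -1 < β j := by
    intro j hj
    induction j with
    | zero => exact hb0
    | succ j ih => exact (ih (by omega)).trans (hlt j (by omega))
  -- The factors (β_j)_{x_j + x_{j-1}} are paired with the site factor at j, because β_j may lie in
  -- (-1, 0); the last one is positive by itself as β_{d+1} > 0.
  have hsplit : weight y β N = (∏ j ∈ Finset.range (d + 1),
        poch (β (j + 1) - β j) (node N y (j + 1) - node N y j)
          / ((node N y (j + 1) - node N y j).factorial
            * poch (β j + 1) (node N y (j + 1) + node N y j)))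
      * poch (β (d + 1)) (node N y (d + 1) + node N y d)
      * ∏ i ∈ Finset.range d, (poch (β (i + 1)) (node N y (i + 1) + node N y i)
        * siteWeight (β (i + 1)) (node N y (i + 1))) := by
    rw [weight, prod_Icc_one, Finset.prod_mul_distrib (s := Finset.range d)]
    have : ∀ j ∈ Finset.range (d + 1),
        poch (β (j + 1) - β j) (node N y (j + 1) - node N y j)
          * poch (β (j + 1)) (node N y (j + 1) + node N y j)
        / (((node N y (j + 1) - node N y j).factorial : ℝ)
          * poch (β j + 1) (node N y (j + 1) + node N y j))
        = poch (β (j + 1) - β j) (node N y (j + 1) - node N y j)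
          / ((node N y (j + 1) - node N y j).factorial
            * poch (β j + 1) (node N y (j + 1) + node N y j))
          * poch (β (j + 1)) (node N y (j + 1) + node N y j) := by
      intros
      ring
    rw [Finset.prod_congr rfl this, Finset.prod_mul_distrib,
      Finset.prod_range_succ (fun j => poch (β (j + 1)) (node N y (j + 1) + node N y j))]
    simp only [siteWeight]
    ring
  rw [hsplit]
  refine mul_pos (mul_pos (Finset.prod_pos fun j hj => ?_) (poch_pos hlast _))
    (Finset.prod_pos fun i hi => ?_)
  · have hj : j ≤ d := Nat.lt_succ_iff.mp (Finset.mem_range.mp hj)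
    exact div_pos (poch_pos (sub_pos.mpr (hlt j hj)) _)
      (mul_pos (by positivity) (poch_pos (by linarith [hgt j hj]) _))
  · have hi := Finset.mem_range.mp hi
    have hb := hgt (i + 1) hi
    have hb' := hne (i + 1) (by omega) hi
    have hle := node_le_succ hy hi.le
    generalize node N y (i + 1) = z at *
    generalize node N y i = t at *
    generalize β (i + 1) = b at *
    rcases z with _ | z
    · obtain rfl : t = 0 := by omega
      simp [siteWeight]
    · have hz : poch (b / 2) (z + 1) ≠ 0 := by
        rw [poch_succ_left]
        exact mul_ne_zero (div_ne_zero hb' two_ne_zero) (poch_pos (by linarith) _).ne'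
      rw [siteWeight_eq hb' hz, show z + 1 + t = (z + t) + 1 by ring, poch_succ_left]
      have h1 := poch_pos (a := b + 1) (by linarith) (z + t)
      have h2 : 0 < b + 2 * (z + 1 : ℕ) := by
        push_cast
        have : (0 : ℝ) ≤ z := Nat.cast_nonneg z
        linarith
      have h3 : b * poch (b + 1) (z + t) * ((b + 2 * (z + 1 : ℕ)) / b)
          = poch (b + 1) (z + t) * (b + 2 * (z + 1 : ℕ)) := by
        field_simp
      rw [h3]
      exact mul_pos h1 h2

theorem neg_one_pow_mul_poch_pos {b : ℝ} {n : ℕ} (h : b + n < 1) : 0 < (-1) ^ n * poch b n := by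
  rw [← poch_reflect]
  exact poch_pos (by linarith) n

/-- For N > 0, a is negative and the Pochhammer symbols in b and a + 1 carry the same sign
(-1)^{z+y}, except at y = z = N. There a + 2N, possibly positive, is the last factor of (a)_{2N+1}
and cancels against the site factor. -/
theorem siteWeight_mul_stepWeight_pos {a b : ℝ} {y z N : ℕ} (hyz : y ≤ z) (hz : z ≤ N)
    (hab : a < b) (hb : b + 2 * N < 1) (ha : a + 2 * N ≠ 0) (ha1 : N = 0 ∨ a < 0)
    (ha2 : a + 2 * N < 1) :
    0 < siteWeight a y * stepWeight a b y z := by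
  rcases Nat.eq_zero_or_pos N with rfl | hN
  · obtain rfl : z = 0 := by omega
    obtain rfl : y = 0 := by omega
    simp [siteWeight, stepWeight]
  · have ha0 : a < 0 := by rcases ha1 with h | h; omega; exact h
    have hyN : (y : ℝ) ≤ N := by exact_mod_cast hyz.trans hz
    have hzN : (z : ℝ) ≤ N := by exact_mod_cast hz
    have hyz' : (y : ℝ) ≤ z := by exact_mod_cast hyz
    have hhalf : poch (a / 2) y ≠ 0 := by
      refine poch_half_ne_zero (right_ne_zero_of_mul (neg_one_pow_mul_poch_pos ?_).ne')
      push_cast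
      linarith
    rw [siteWeight_eq ha0.ne hhalf, stepWeight]
    have h1 := poch_pos (sub_pos.mpr hab) (z - y)
    have h2 : 0 < (-1) ^ (z + y) * poch b (z + y) := neg_one_pow_mul_poch_pos (by
      push_cast
      linarith)
    have h3 : 0 < (-1) ^ (z + y) * ((a + 2 * y) / a / poch (a + 1) (z + y)) := by
      rcases Nat.lt_or_ge (z + y) (2 * N) with h | h
      · have hr : ((z + y : ℕ) : ℝ) + 1 ≤ 2 * N := by exact_mod_cast h
        have h4 : 0 < (-1) ^ (z + y) * poch (a + 1) (z + y) :=
          neg_one_pow_mul_poch_pos (by linarith)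
        push_cast at hr
        have h5 : 0 < (a + 2 * y) / a := div_pos_of_neg_of_neg (by linarith) ha0
        have h6 : (-1 : ℝ) ^ (z + y) * ((a + 2 * y) / a / poch (a + 1) (z + y))
            = (a + 2 * y) / a / ((-1) ^ (z + y) * poch (a + 1) (z + y)) := by
          rcases neg_one_pow_eq_or ℝ (z + y) with e | e <;> rw [e] <;> ring
        rw [h6]
        exact div_pos h5 h4
      · obtain rfl : y = N := by omega
        obtain rfl : z = y := by omega
        rw [← two_mul, div_div, ← poch_succ_left, poch_succ]
        push_cast
        rw [← div_div, div_right_comm, div_self ha, pow_mul]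
        have h4 : 0 < (-1) ^ (2 * z) * poch a (2 * z) :=
          neg_one_pow_mul_poch_pos (by push_cast; exact ha2)
        rw [pow_mul] at h4
        simpa using h4
    have hf : (0 : ℝ) < (z - y).factorial := by positivity
    have hs := neg_one_pow_mul_self (z + y)
    have h5 := div_pos (mul_pos h1 (mul_pos h2 h3)) hf
    refine lt_of_lt_of_eq h5 ?_
    simp only [div_eq_mul_inv, mul_inv]
    linear_combination (poch (b - a) (z - y) * poch b (z + y) * ((a + 2 * y) * a⁻¹
      * (poch (a + 1) (z + y))⁻¹) * ((z - y).factorial : ℝ)⁻¹) * hs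

/-- Positivity of the dual weight. -/
theorem weight_dualParam_pos {d N : ℕ} {β : ℕ → ℝ} (hb0 : -1 < β 0) (h01 : β 0 < β 1)
    (hβ : ∀ j, 1 ≤ j → j ≤ d → β j < β (j + 1)) (hlast : 0 < β (d + 1))
    (hne : ∀ j, 2 ≤ j → j ≤ d + 1 → β j ≠ β 0 + 1) {y : Fin d → ℕ} (hy : y ∈ simplex d N) :
    0 < weight y (dualParam d β N) N := by
  have hgt : ∀ j ≤ d, β 0 < β (j + 1) := by
    intro j hj
    induction j with
    | zero => exact h01
    | succ j ih => exact (ih (by omega)).trans (hβ (j + 1) (by omega) hj)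
  rw [weight_eq, dualParam_zero, dualParam_succ, Nat.sub_zero]
  refine mul_pos ?_ (Finset.prod_pos fun i hi => ?_)
  · rw [stepWeight, Nat.sub_zero, Nat.add_zero]
    have hx := node_le hy 1
    generalize node N y 1 = x at *
    have hlast' := hgt d le_rfl
    rcases Nat.eq_zero_or_pos x with rfl | hx0
    · simp
    · have h1 : (1 : ℝ) ≤ x := by exact_mod_cast hx0
      have h2 : (x : ℝ) ≤ N := by exact_mod_cast hx
      have h3 : 0 < (-1) ^ x * poch (β 0 - β (d + 1) - 2 * N + 1 - β 0) x :=
        neg_one_pow_mul_poch_pos (by linarith)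
      have h4 : 0 < (-1) ^ x * poch (β 0 - β (d + 1) - 2 * N + 1) x :=
        neg_one_pow_mul_poch_pos (by linarith)
      refine div_pos ?_ (mul_pos (by positivity) (poch_pos (by linarith) _))
      have hs := neg_one_pow_mul_self x
      refine lt_of_lt_of_eq (mul_pos h3 h4) ?_
      linear_combination (poch (β 0 - β (d + 1) - 2 * N + 1 - β 0) x
        * poch (β 0 - β (d + 1) - 2 * N + 1) x) * hs
  · have hi := Finset.mem_range.mp hi
    rw [dualParam_succ, dualParam_succ]
    have h1 := hβ (d + 1 - (i + 1)) (by omega) (by omega)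
    have h2 := hgt (d - (i + 1)) (by omega)
    have h3 := hne (d + 1 - i) (by omega) (by omega)
    rw [show d - (i + 1) + 1 = d + 1 - (i + 1) by omega] at h2
    rw [show d + 1 - (i + 1) + 1 = d + 1 - i by omega] at h1
    -- With a = β_0 - β_j - 2N + 1, the condition a + 2N ≠ 0 is β_j ≠ β_0 + 1, and a + 2N < 1 is β_0
    -- < β_j.
    refine siteWeight_mul_stepWeight_pos (node_le_succ hy (j := i + 1) hi) (node_le hy _)
      (by linarith) (by linarith) (fun h => h3 (by linarith)) ?_ (by linarith)
    rcases Nat.eq_zero_or_pos N with h | h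
    · exact Or.inl h
    · right
      have : (1 : ℝ) ≤ N := by exact_mod_cast h
      linarith

end MultiRacah

theorem mainTheorem3 (d N : ℕ) (hd : 1 ≤ d) (β : ℕ → ℝ) (hβ0 : -1 < β 0)
    (hβ : ∀ j, 1 ≤ j → j ≤ d → β j < β (j + 1)) :
    ((∀ y ∈ MultiRacah.simplex d N, 0 < MultiRacah.weight y β N) →
      (∀ y ∈ MultiRacah.simplex d N,
        0 < MultiRacah.weight y (MultiRacah.dualParam d β N) N) →
      ∀ x ∈ MultiRacah.simplex d N, ∀ ν : Fin d → ℕ, ∑ i, ν i ≤ N →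
        MultiRacah.dualVar ν N ∈ MultiRacah.simplex d N ∧
        ∑ i, MultiRacah.dualIndex x N i ≤ N ∧
        0 < MultiRacah.racahNorm ν β N ∧
        0 < MultiRacah.racahNorm (MultiRacah.dualIndex x N) (MultiRacah.dualParam d β N) N ∧
        Real.sqrt (MultiRacah.weight x β N) * MultiRacah.orthoRacah ν x β N
          = Real.sqrt (MultiRacah.weight (MultiRacah.dualVar ν N)
              (MultiRacah.dualParam d β N) N)
            * MultiRacah.orthoRacah (MultiRacah.dualIndex x N) (MultiRacah.dualVar ν N)
              (MultiRacah.dualParam d β N) N) ∧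
    (β 0 < β 1 → 0 < β (d + 1) → (∀ j, 1 ≤ j → j ≤ d → β j ≠ 0) →
      (∀ j, 2 ≤ j → j ≤ d + 1 → β j ≠ β 0 + 1) →
      ∀ y ∈ MultiRacah.simplex d N,
        0 < MultiRacah.weight y β N ∧
        0 < MultiRacah.weight y (MultiRacah.dualParam d β N) N) := by
  refine ⟨fun hw hw' x hx ν hν => ?_, fun h01 hlast hne hne' y hy => ?_⟩
  · have hν' : MultiRacah.partialSum ν d ≤ N := by rwa [MultiRacah.partialSum_eq_sum]
    refine ⟨MultiRacah.dualVar_mem ν N, ?_,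
      MultiRacah.duality_of_pos hd hβ0 hβ hw hw' hx hν'⟩
    rw [← MultiRacah.partialSum_eq_sum, MultiRacah.partialSum_dualIndex hx le_rfl]
    exact Nat.sub_le _ _
  · exact ⟨MultiRacah.weight_pos hβ0 h01 hβ hlast hne hy,
      MultiRacah.weight_dualParam_pos hβ0 h01 hβ hlast hne' hy⟩
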